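/- Let $n\ge 1$ and let $f:\mathbb{R}^n\to\mathbb{R}$ be a metric function, i.e. a $C^2$ function such that $|\nabla f|$ is constant on each connected component of each level set of $f$. Assume that every connected component of the critical set $\{\nabla f=0\}$ is either a single point or a regular ($C^1$ embedded) surface of some dimension $r$ with $1\le r\le n-1$, and that every such component is isolated from the others (it is relatively open in the critical set). Call the connected components of the level sets of $f$ the level surfaces of $f$, and call a level surface critical if $\nabla f=0$ on it. Then the level surfaces of $f$ form a $C^\infty$ foliation with singularities of $\mathbb{R}^n$: they are connected embedded $C^\infty$ submanifolds partitioning $\mathbb{R}^n$, and around each point $x$, lying on a level surface of dimension $d$, there is a $C^\infty$ chart $\psi:U\to V_1\times V_2\subseteq\mathbb{R}^d\times\mathbb{R}^{n-d}$ with $\psi(x)=(0,0)$ such that every level surface $L$ meeting $U$ satisfies $L\cap U=\psi^{-1}(V_1\times l)$, where $l=\{v\in V_2:\psi^{-1}(0,v)\in L\}$. Moreover, this foliation is of one of the following types: 1. it consists of all hyperplanes parallel to a given hyperplane; 2. it consists of all hyperspheres with a given centre, together with this centre; 3. for some $k$ with $1\le k\le n-2$, it consists of all cylinders $\{p+v+w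 : v\in W^\perp,\ |v|=\rho,\ w\in W\}\cong S^{n-k-1}\times\mathbb{R}^k$ with $\rho>0$, together with the singular leaf $p+W\cong\mathbb{R}^k$, where $p\in\mathbb{R}^n$ and $W\subseteq\mathbb{R}^n$ is a $k$-dimensional linear subspace; here $k$ is the minimum of the dimensions of the critical level surfaces of $f$. -/

import Mathlib

open scoped ContDiff

/-- A `k`-dimensional regular surface (embedded submanifold) of class `C^m` in `ℝⁿ`: around each
of its points a local `C^m` diffeomorphism of `ℝⁿ` flattens it onto a `k`-dimensional linear
subspace. For `k = 0` this means a set of isolated points, for `k = n` an open set. -/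
def IsRegularSurface {n : ℕ} (m : WithTop ℕ∞) (k : ℕ) (S : Set (EuclideanSpace ℝ (Fin n))) :
    Prop :=
  ∀ p ∈ S, ∃ (Φ : OpenPartialHomeomorph (EuclideanSpace ℝ (Fin n)) (EuclideanSpace ℝ (Fin n)))
    (W : Submodule ℝ (EuclideanSpace ℝ (Fin n))),
    p ∈ Φ.source ∧ ContDiffOn ℝ m Φ Φ.source ∧ ContDiffOn ℝ m Φ.symm Φ.target ∧
      Module.finrank ℝ W = k ∧ ∀ x ∈ Φ.source, x ∈ S ↔ Φ x ∈ W

/-- The level surface of `f` through `x`: the connected component of `x` in its level set. -/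
def levelSurface {n : ℕ} (f : EuclideanSpace ℝ (Fin n) → ℝ) (x : EuclideanSpace ℝ (Fin n)) :
    Set (EuclideanSpace ℝ (Fin n)) :=
  connectedComponentIn (f ⁻¹' {f x}) x

/-- The family of all level surfaces of `f`. -/
def levelSurfaces {n : ℕ} (f : EuclideanSpace ℝ (Fin n) → ℝ) :
    Set (Set (EuclideanSpace ℝ (Fin n))) :=
  Set.range (levelSurface f)

/-- A metric function: of class `C²`, with gradient of constant length on each connected component
of each level set. -/
def IsMetricFunction {n : ℕ} (f : EuclideanSpace ℝ (Fin n) → ℝ) : Prop :=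
  ContDiff ℝ 2 f ∧ ∀ x, ∀ y ∈ levelSurface f x, ‖gradient f y‖ = ‖gradient f x‖

/-- The set of critical points of `f`. -/
def criticalSet {n : ℕ} (f : EuclideanSpace ℝ (Fin n) → ℝ) : Set (EuclideanSpace ℝ (Fin n)) :=
  {x | gradient f x = 0}

/-- Every connected component of the critical set is either a point or a regular surface (of
dimension between `1` and `n - 1`), and is isolated from the other components. -/
def HasRegularCriticalSet {n : ℕ} (f : EuclideanSpace ℝ (Fin n) → ℝ) : Prop :=
  ∀ p ∈ criticalSet f,
    (connectedComponentIn (criticalSet f) p = {p} ∨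
      ∃ r : ℕ, 1 ≤ r ∧ r < n ∧ IsRegularSurface 1 r (connectedComponentIn (criticalSet f) p)) ∧
    ∃ O : Set (EuclideanSpace ℝ (Fin n)), IsOpen O ∧
      O ∩ criticalSet f = connectedComponentIn (criticalSet f) p

/-- A foliation with singularities of class `C^m` of `ℝⁿ`, all of whose leaves are embedded: a
partition into connected submanifolds such that around each point `x`, lying on a leaf of
dimension `k` say, there is a `C^m` chart onto a product `V₁ × V₂ ⊆ ℝᵏ × ℝⁿ⁻ᵏ`, centred at `x`,
in which every leaf is of the form `V₁ × l`. -/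
structure IsSingularFoliation {n : ℕ} (m : WithTop ℕ∞)
    (F : Set (Set (EuclideanSpace ℝ (Fin n)))) : Prop where
  isPartition : Setoid.IsPartition F
  isConnected : ∀ L ∈ F, IsConnected L
  exists_chart : ∀ L₀ ∈ F, ∃ k : ℕ, k ≤ n ∧ IsRegularSurface m k L₀ ∧ ∀ x ∈ L₀,
    ∃ (ψ : OpenPartialHomeomorph (EuclideanSpace ℝ (Fin n))
        (EuclideanSpace ℝ (Fin k) × EuclideanSpace ℝ (Fin (n - k))))
      (V₁ : Set (EuclideanSpace ℝ (Fin k))) (V₂ : Set (EuclideanSpace ℝ (Fin (n - k)))),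
      x ∈ ψ.source ∧ ContDiffOn ℝ m ψ ψ.source ∧ ContDiffOn ℝ m ψ.symm ψ.target ∧
        ψ.target = V₁ ×ˢ V₂ ∧ ψ x = (0, 0) ∧
        ∀ L ∈ F, (L ∩ ψ.source).Nonempty →
          L ∩ ψ.source = ψ.symm '' (V₁ ×ˢ {v | v ∈ V₂ ∧ ψ.symm (0, v) ∈ L})

/-- The cylinder `S × W` of radius `r` around the affine plane `p + W`, where `S` is the sphere of
radius `r` about the origin in the orthogonal complement of `W`. -/
def roundCylinder {n : ℕ} (p : EuclideanSpace ℝ (Fin n))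
    (W : Submodule ℝ (EuclideanSpace ℝ (Fin n))) (r : ℝ) : Set (EuclideanSpace ℝ (Fin n)) :=
  {x | ∃ v ∈ Wᗮ, ∃ w ∈ W, ‖v‖ = r ∧ x = p + v + w}

/-- The affine plane through `p` with direction `W`. -/
def planeThrough {n : ℕ} (p : EuclideanSpace ℝ (Fin n))
    (W : Submodule ℝ (EuclideanSpace ℝ (Fin n))) : Set (EuclideanSpace ℝ (Fin n)) :=
  {x | ∃ w ∈ W, x = p + w}

/-- All hyperplanes parallel to a given one. -/
def IsParallelHyperplanes {n : ℕ} (F : Set (Set (EuclideanSpace ℝ (Fin n)))) : Prop :=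
  ∃ a : EuclideanSpace ℝ (Fin n), a ≠ 0 ∧ F = {L | ∃ c : ℝ, L = {x | inner ℝ a x = c}}

/-- All hyperspheres about a point, and that point. -/
def IsConcentricSpheres {n : ℕ} (F : Set (Set (EuclideanSpace ℝ (Fin n)))) : Prop :=
  ∃ p : EuclideanSpace ℝ (Fin n), F = {L | ∃ r : ℝ, 0 < r ∧ L = Metric.sphere p r} ∪ {{p}}

/-- All round cylinders `Sⁿ⁻ᵏ⁻¹ × ℝᵏ` about a `k`-dimensional plane, and that plane. -/
def IsConcentricCylinders {n : ℕ} (k : ℕ) (F : Set (Set (EuclideanSpace ℝ (Fin n)))) : Prop :=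
  ∃ (p : EuclideanSpace ℝ (Fin n)) (W : Submodule ℝ (EuclideanSpace ℝ (Fin n))),
    Module.finrank ℝ W = k ∧
      F = {L | ∃ r : ℝ, 0 < r ∧ L = roundCylinder p W r} ∪ {planeThrough p W}

/-- The dimensions of the critical level surfaces of `f`. -/
def criticalDimensions {n : ℕ} (f : EuclideanSpace ℝ (Fin n) → ℝ) : Set ℕ :=
  {r | ∃ L ∈ levelSurfaces f, L ⊆ criticalSet f ∧ IsRegularSurface 1 r L}

/-!
Since `‖∇f‖` is constant on level surfaces, the unit normal `ν = ∇f / ‖∇f‖` is locally the gradient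
of a function, and hence constant along the lines in direction `ν`. These normal lines continue
through critical points, where their directions are normal to the critical set. A vector `v` tangent
to the level surface of `y` with `v + t • ν'(y) v = 0` is called focal at distance `t`. If
`y + t • ν y` is critical, then `v` is not tangent to the critical set there: on either side of the
critical point, balls centred on the normal line contain no critical points, which keeps the
critical set too flat.

If all critical components have codimension one, there are thus no focal vectors, while an
eigenvalue `κ ≠ 0` of `ν'` would produce one at distance `-1 / κ`. So `ν' = 0`, and the level
surfaces are parallel hyperplanes. If a critical component `C` has codimension at least two at `p`,
then a normal line meets `C` at most once: reflections in the points of intersection would produce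
infinitely many of them, while each is at distance `-1 / κ` for an eigenvalue `κ` of `ν'` at one
regular point. It follows that `C` lies in its tangent plane at `p`, hence fills it, and `f` is a
function of the distance to that plane.
-/

open scoped RealInnerProductSpace Gradient
open Set Filter Topology Metric Asymptotics

section Straightening

variable {E F : Type*} [NormedAddCommGroup E] [NormedAddCommGroup F] {m : WithTop ℕ∞}

/-- A `C^m` chart `T` centred at `x`: it is `C^m` with `C^m` inverse and maps `x` to `0`. -/
structure IsCenteredChart [NormedSpace ℝ E] [NormedSpace ℝ F] (m : WithTop ℕ∞)
    (T : OpenPartialHomeomorph E F) (x : E) : Prop where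
  mem_source : x ∈ T.source
  contDiffOn : ContDiffOn ℝ m T T.source
  contDiffOn_symm : ContDiffOn ℝ m T.symm T.target
  apply_self : T x = 0

theorem IsCenteredChart.zero_mem_target [NormedSpace ℝ E] [NormedSpace ℝ F]
    {T : OpenPartialHomeomorph E F} {x : E} (hT : IsCenteredChart m T x) : 0 ∈ T.target :=
  hT.apply_self ▸ T.map_source hT.mem_source

theorem IsCenteredChart.symm_zero [NormedSpace ℝ E] [NormedSpace ℝ F]
    {T : OpenPartialHomeomorph E F} {x : E} (hT : IsCenteredChart m T x) : T.symm 0 = x :=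
  hT.apply_self ▸ T.left_inv hT.mem_source

theorem exists_isCenteredChart [NormedSpace ℝ E] [CompleteSpace E] [NormedSpace ℝ F]
    {Φ : E → F} {A : E ≃L[ℝ] F} {x : E} (hΦ : ContDiff ℝ m Φ) (hm : m ≠ 0)
    (hA : HasFDerivAt Φ (A : E →L[ℝ] F) x) (hx : Φ x = 0) :
    ∃ T : OpenPartialHomeomorph E F, IsCenteredChart m T x ∧ ⇑T = Φ := by
  let T₀ := hΦ.contDiffAt.toOpenPartialHomeomorph Φ hA hm
  let U : Set E := fderiv ℝ Φ ⁻¹' range ((↑) : (E ≃L[ℝ] F) → E →L[ℝ] F)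
  have hU : IsOpen U := ContinuousLinearEquiv.isOpen.preimage (hΦ.continuous_fderiv hm)
  let T := T₀.restrOpen U hU
  have hT : ⇑T = Φ := rfl
  refine ⟨T, ⟨⟨hΦ.contDiffAt.mem_toOpenPartialHomeomorph_source hA hm, A, hA.fderiv.symm⟩,
    hT ▸ hΦ.contDiffOn, fun b hb => ContDiffAt.contDiffWithinAt ?_, hx⟩, hT⟩
  obtain ⟨B, hB⟩ := (T.map_target hb).2
  refine T.contDiffAt_symm (f₀' := B) hb ?_ hΦ.contDiffAt
  rw [hB]
  exact (hΦ.differentiable hm _).hasFDerivAt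

/-- The chart is `y ↦ (y - x) + |a|⁻² (H y - H x - ⟨a, y - x⟩) a`, whose derivative at `x` is the
identity. -/
theorem exists_straightening [InnerProductSpace ℝ E] [CompleteSpace E] {H : E → ℝ} {x a : E}
    (hH : ContDiff ℝ m H) (hm : m ≠ 0) (ha : a ≠ 0) (hHa : HasGradientAt H a x) :
    ∃ T : OpenPartialHomeomorph E E, IsCenteredChart m T x ∧
      HasFDerivAt T (ContinuousLinearMap.id ℝ E) x ∧ ∀ y, ⟪a, T y⟫ = H y - H x := by
  let Φ : E → E := fun y => (y - x) + ((H y - H x) - ⟪a, y - x⟫) • ((‖a‖ ^ 2)⁻¹ • a)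
  have hsub : ContDiff ℝ m fun y : E => y - x := contDiff_id.sub contDiff_const
  have hΦ : ContDiff ℝ m Φ :=
    hsub.add (((hH.sub contDiff_const).sub (contDiff_const.inner ℝ hsub)).smul contDiff_const)
  have hd : HasFDerivAt Φ (ContinuousLinearMap.id ℝ E) x := by
    have hsub' : HasFDerivAt (fun y : E => y - x) (ContinuousLinearMap.id ℝ E) x :=
      (hasFDerivAt_id x).sub_const x
    have hinner : HasFDerivAt (fun y => ⟪a, y - x⟫) (innerSL ℝ a) x :=
      (innerSL ℝ a).hasFDerivAt.comp x hsub'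
    refine (hsub'.add (((hHa.hasFDerivAt.sub_const (H x)).sub hinner).smul_const
      ((‖a‖ ^ 2)⁻¹ • a))).congr_fderiv ?_
    ext v
    simp
  obtain ⟨T, hT, hTΦ⟩ := exists_isCenteredChart (A := ContinuousLinearEquiv.refl ℝ E) hΦ hm hd
    (by simp [Φ])
  refine ⟨T, hT, hTΦ ▸ hd, fun y => ?_⟩
  have := norm_ne_zero_iff.2 ha
  simp only [hTΦ, Φ, inner_add_right, inner_smul_right, real_inner_self_eq_norm_sq]
  field_simp
  ring

end Straightening

section LevelSets

variable {E : Type*} [NormedAddCommGroup E] [InnerProductSpace ℝ E]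

theorem hasDerivAt_add_smul (x e : E) (t : ℝ) : HasDerivAt (fun s : ℝ => x + s • e) e t := by
  simpa using ((hasDerivAt_id t).smul_const e).const_add x

variable [CompleteSpace E] {f : E → ℝ} {x : E}

theorem hasDerivAt_comp_of_differentiable (hf : Differentiable ℝ f) {c : ℝ → E} {v : E} {t : ℝ}
    (hc : HasDerivAt c v t) : HasDerivAt (fun s => f (c s)) ⟪∇ f (c t), v⟫ t :=
  (hf (c t)).hasGradientAt.hasFDerivAt.comp_hasDerivAt t hc

theorem eventually_exists_path_in_level (hf : ContDiff ℝ 1 f) (hx : ∇ f x ≠ 0) {N : Set E}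
    (hN : N ∈ 𝓝 x) :
    ∀ᶠ y in 𝓝 x, f y = f x → ∃ c : ℝ → E, c 0 = x ∧ c 1 = y ∧
      ∀ s ∈ Icc (0 : ℝ) 1, c s ∈ N ∧ f (c s) = f x ∧ DifferentiableAt ℝ c s := by
  have hgrad := (hf.differentiable one_ne_zero x).hasGradientAt
  obtain ⟨T, hT, -, hTf⟩ := exists_straightening hf one_ne_zero hx hgrad
  have hnear : ∀ᶠ q in 𝓝 (0 : E), q ∈ T.target ∧ T.symm q ∈ N := by
    refine (T.open_target.eventually_mem hT.zero_mem_target).and ?_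
    exact (T.continuousAt_symm hT.zero_mem_target).eventually_mem (by rwa [hT.symm_zero])
  obtain ⟨r, hr, hball⟩ := Metric.eventually_nhds_iff_ball.1 hnear
  have hTball : ∀ᶠ y in 𝓝 x, T y ∈ ball (0 : E) r :=
    (T.continuousAt hT.mem_source).eventually_mem (hT.apply_self ▸ ball_mem_nhds _ hr)
  filter_upwards [hTball, T.open_source.mem_nhds hT.mem_source] with y hy hys hfy
  refine ⟨fun s => T.symm (s • T y), by simp [hT.symm_zero], by simp [T.left_inv hys],
    fun s hs => ?_⟩
  obtain ⟨htarget, hmem⟩ := hball _ ((convex_ball (0 : E) r).smul_mem_of_zero_mem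
    (mem_ball_self hr) hy hs)
  refine ⟨hmem, ?_, ?_⟩
  · rw [← sub_eq_zero, ← hTf, T.right_inv htarget, inner_smul_right, hTf, hfy, sub_self, mul_zero]
  · have hsymm := (hT.contDiffOn_symm.contDiffAt
      (T.open_target.mem_nhds htarget)).differentiableAt one_ne_zero
    exact hsymm.comp s ((hasDerivAt_id s).smul_const (T y)).differentiableAt

theorem exists_curve_in_level (hf : ContDiff ℝ 1 f) (hx : ∇ f x ≠ 0) {v : E}
    (hv : ⟪∇ f x, v⟫ = 0) :
    ∃ c : ℝ → E, c 0 = x ∧ HasDerivAt c v 0 ∧ ∀ᶠ s in 𝓝 (0 : ℝ), f (c s) = f x := by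
  have hgrad := (hf.differentiable one_ne_zero x).hasGradientAt
  obtain ⟨T, hT, hTd, hTf⟩ := exists_straightening hf one_ne_zero hx hgrad
  have hline : HasDerivAt (fun s : ℝ => s • v) v 0 := by
    simpa using hasDerivAt_add_smul 0 v 0
  refine ⟨fun s => T.symm (s • v), by simp [hT.symm_zero], ?_, ?_⟩
  · have hsymm : HasFDerivAt T.symm (ContinuousLinearMap.id ℝ E) ((0 : ℝ) • v) := by
      rw [zero_smul]
      refine T.hasFDerivAt_symm (f' := ContinuousLinearEquiv.refl ℝ E) hT.zero_mem_target ?_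
      rwa [hT.symm_zero]
    exact hsymm.comp_hasDerivAt (0 : ℝ) hline
  · filter_upwards [hline.continuousAt.eventually_mem
      (T.open_target.mem_nhds (by simpa using hT.zero_mem_target))] with s hs
    rw [← sub_eq_zero, ← hTf, T.right_inv hs, inner_smul_right, hv, mul_zero]

theorem eventually_eq_of_fderiv_eq_zero_on_ker {F : Type*} [NormedAddCommGroup F] [NormedSpace ℝ F]
    {k : E → F} (hf : ContDiff ℝ 1 f) (hx : ∇ f x ≠ 0)
    (hk : ∀ᶠ y in 𝓝 x, DifferentiableAt ℝ k y ∧ ∀ v, ⟪∇ f y, v⟫ = 0 → fderiv ℝ k y v = 0) :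
    ∀ᶠ y in 𝓝 x, f y = f x → k y = k x := by
  filter_upwards [eventually_exists_path_in_level hf hx hk] with y hy hfy
  obtain ⟨c, rfl, rfl, hc⟩ := hy hfy
  have hderiv : ∀ s ∈ Ico (0 : ℝ) 1, HasDerivWithinAt (fun s => k (c s)) 0 (Ici s) s := by
    intro s hs
    obtain ⟨⟨hks, hker⟩, hfs, hcs⟩ := hc s (Ico_subset_Icc_self hs)
    have htangent : ⟪∇ f (c s), deriv c s⟫ = 0 := by
      have hconst : HasDerivWithinAt (fun t => f (c t)) 0 (Ici s) s := by
        refine (hasDerivWithinAt_const s (Ici s) (f (c 0))).congr_of_eventuallyEq ?_ hfs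
        filter_upwards [Icc_mem_nhdsGE hs.2] with t ht
        exact (hc t ⟨hs.1.trans ht.1, ht.2⟩).2.1
      exact (uniqueDiffWithinAt_Ici s).eq_deriv _ (hasDerivAt_comp_of_differentiable
        (hf.differentiable one_ne_zero) hcs.hasDerivAt).hasDerivWithinAt hconst
    rw [← hker _ htangent]
    exact (hks.hasFDerivAt.comp_hasDerivAt s hcs.hasDerivAt).hasDerivWithinAt
  refine constant_of_has_deriv_right_zero (fun s hs => ?_) hderiv 1 (by simp)
  obtain ⟨⟨hks, -⟩, -, hcs⟩ := hc s hs
  exact (hks.continuousAt.comp hcs.continuousAt).continuousWithinAt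

end LevelSets

section LevelSurfaces

variable {n : ℕ} {f : EuclideanSpace ℝ (Fin n) → ℝ} {x y : EuclideanSpace ℝ (Fin n)}

theorem mem_levelSurface_self (f : EuclideanSpace ℝ (Fin n) → ℝ) (x : EuclideanSpace ℝ (Fin n)) :
    x ∈ levelSurface f x :=
  mem_connectedComponentIn rfl

theorem eq_of_mem_levelSurface (h : y ∈ levelSurface f x) : f y = f x :=
  (connectedComponentIn_subset _ _ h : y ∈ f ⁻¹' {f x})

theorem isPreconnected_levelSurface (f : EuclideanSpace ℝ (Fin n) → ℝ)
    (x : EuclideanSpace ℝ (Fin n)) : IsPreconnected (levelSurface f x) :=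
  isPreconnected_connectedComponentIn

theorem subset_levelSurface {S : Set (EuclideanSpace ℝ (Fin n))} (hS : IsPreconnected S)
    (hx : x ∈ S) (h : ∀ y ∈ S, f y = f x) : S ⊆ levelSurface f x :=
  hS.subset_connectedComponentIn hx h

theorem isClosed_levelSurface (hf : Continuous f) (x : EuclideanSpace ℝ (Fin n)) :
    IsClosed (levelSurface f x) :=
  isClosed_of_closure_subset <|
    (isPreconnected_levelSurface f x).closure.subset_connectedComponentIn
      (subset_closure (mem_levelSurface_self f x))
      (closure_minimal (connectedComponentIn_subset _ _) (isClosed_singleton.preimage hf))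

theorem levelSurface_eq_of_mem (h : y ∈ levelSurface f x) :
    levelSurface f y = levelSurface f x := by
  have hy := eq_of_mem_levelSurface h
  unfold levelSurface at *
  rw [hy]
  exact (connectedComponentIn_eq h).symm

theorem eventually_mem_levelSurface (hf : ContDiff ℝ 1 f) (hx : ∇ f x ≠ 0) :
    ∀ᶠ y in 𝓝 x, f y = f x → y ∈ levelSurface f x := by
  filter_upwards [eventually_exists_path_in_level hf hx univ_mem] with y hy hfy
  obtain ⟨c, rfl, rfl, hc⟩ := hy hfy
  have hcont : ContinuousOn c (Icc 0 1) := fun s hs =>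
    (hc s hs).2.2.continuousAt.continuousWithinAt
  refine subset_levelSurface (isPreconnected_Icc.image c hcont) ⟨0, by simp, rfl⟩ ?_
    ⟨1, by simp, rfl⟩
  rintro _ ⟨s, hs, rfl⟩
  exact (hc s hs).2.1

theorem exists_curve_in_levelSurface (hf : ContDiff ℝ 1 f) (hx : ∇ f x ≠ 0)
    {v : EuclideanSpace ℝ (Fin n)} (hv : ⟪∇ f x, v⟫ = 0) :
    ∃ c : ℝ → EuclideanSpace ℝ (Fin n), c 0 = x ∧ HasDerivAt c v 0 ∧
      ∀ᶠ s in 𝓝 (0 : ℝ), c s ∈ levelSurface f x := by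
  obtain ⟨c, rfl, hc, hs⟩ := exists_curve_in_level hf hx hv
  refine ⟨c, rfl, hc, ?_⟩
  filter_upwards [hs, hc.continuousAt.eventually (eventually_mem_levelSurface hf hx)] with s h1 h2
  exact h2 h1

theorem eqOn_levelSurface_of_fderiv_eq_zero_on_ker {F : Type*} [NormedAddCommGroup F]
    [NormedSpace ℝ F] {k : EuclideanSpace ℝ (Fin n) → F} (hf : ContDiff ℝ 1 f)
    (hx : ∀ y ∈ levelSurface f x, ∇ f y ≠ 0)
    (hk : ∀ y ∈ levelSurface f x, ∀ᶠ z in 𝓝 y, DifferentiableAt ℝ k z ∧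
      ∀ v, ⟪∇ f z, v⟫ = 0 → fderiv ℝ k z v = 0) (hy : y ∈ levelSurface f x) : k y = k x := by
  refine ((isPreconnected_levelSurface f x).induction₂ (fun a b => k b = k a) ?_
    (fun _ _ _ _ _ _ h h' => h'.trans h) (fun _ _ _ _ h => h.symm)
    (mem_levelSurface_self f x) hy)
  intro z hz
  have hconst := eventually_eq_of_fderiv_eq_zero_on_ker hf (hx z hz) (hk z hz)
  filter_upwards [mem_nhdsWithin_of_mem_nhds hconst, self_mem_nhdsWithin] with w h hw
  exact h ((eq_of_mem_levelSurface hw).trans (eq_of_mem_levelSurface hz).symm)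

end LevelSurfaces

section UnitNormal

variable {E : Type*} [NormedAddCommGroup E] [InnerProductSpace ℝ E]

theorem inner_fderiv_eq_zero_of_norm_eq_const {k : E → E} {x : E} {r : ℝ}
    (hk : DifferentiableAt ℝ k x) (h : ∀ᶠ y in 𝓝 x, ‖k y‖ = r) (v : E) :
    ⟪k x, fderiv ℝ k x v⟫ = 0 := by
  have hconst : (fun y => ‖k y‖ ^ 2) =ᶠ[𝓝 x] fun _ => r ^ 2 := h.mono fun y hy => by
    simp only [hy]
  have hderiv := hk.hasFDerivAt.norm_sq.unique
    ((hasFDerivAt_const (r ^ 2) x).congr_of_eventuallyEq hconst)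
  simpa using congrArg (fun A => A v) hderiv

variable [CompleteSpace E] {f : E → ℝ} {x e : E}

theorem contDiff_gradient (hf : ContDiff ℝ 2 f) : ContDiff ℝ 1 (∇ f) :=
  (InnerProductSpace.toDual ℝ E).symm.contDiff.comp (hf.fderiv_right (m := 1) (by norm_num))

theorem continuous_gradient (hf : ContDiff ℝ 1 f) : Continuous (∇ f) :=
  (InnerProductSpace.toDual ℝ E).symm.continuous.comp (hf.continuous_fderiv one_ne_zero)

theorem hasFDerivAt_gradient (hf : ContDiff ℝ 2 f) (x : E) :
    HasFDerivAt (∇ f) (fderiv ℝ (∇ f) x) x :=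
  ((contDiff_gradient hf).differentiable one_ne_zero x).hasFDerivAt

theorem inner_fderiv_gradient_comm (hf : ContDiff ℝ 2 f) (x v w : E) :
    ⟪fderiv ℝ (∇ f) x v, w⟫ = ⟪fderiv ℝ (∇ f) x w, v⟫ := by
  have hessian (v w : E) : ⟪fderiv ℝ (∇ f) x v, w⟫ = fderiv ℝ (fderiv ℝ f) x v w := by
    have hd := (hf.fderiv_right (m := 1) (by norm_num)).differentiable one_ne_zero x
    have hinner := (hasFDerivAt_gradient hf x).inner ℝ (hasFDerivAt_const w x)
    simp only [inner_gradient_left] at hinner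
    simpa using congrArg (fun A => A v)
      (hinner.unique (hd.hasFDerivAt.clm_apply (hasFDerivAt_const w x)))
  rw [hessian, hessian]
  exact hf.contDiffAt.isSymmSndFDerivAt (by simp) v w

/-- The unit normal field `∇f / |∇f|` of the level sets of `f`; it is zero at critical points. -/
noncomputable def unitNormal (f : E → ℝ) (x : E) : E :=
  NormedSpace.normalize (∇ f x)

/-- The gradient of `f` at `x` is a multiple of the unit vector `e`. -/
def IsAligned (f : E → ℝ) (x e : E) : Prop :=
  ∇ f x = ⟪∇ f x, e⟫ • e

theorem norm_unitNormal (hx : ∇ f x ≠ 0) : ‖unitNormal f x‖ = 1 :=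
  NormedSpace.norm_normalize hx

theorem inner_unitNormal_self (hx : ∇ f x ≠ 0) : ⟪unitNormal f x, unitNormal f x⟫ = 1 := by
  rw [real_inner_self_eq_norm_sq, norm_unitNormal hx, one_pow]

theorem norm_smul_unitNormal (f : E → ℝ) (x : E) : ‖∇ f x‖ • unitNormal f x = ∇ f x :=
  NormedSpace.norm_smul_normalize _

theorem inner_gradient_eq_norm_mul (f : E → ℝ) (x v : E) :
    ⟪∇ f x, v⟫ = ‖∇ f x‖ * ⟪unitNormal f x, v⟫ := by
  conv_lhs => rw [← norm_smul_unitNormal f x]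
  rw [real_inner_smul_left]

theorem inner_gradient_eq_zero_iff (hx : ∇ f x ≠ 0) {v : E} :
    ⟪∇ f x, v⟫ = 0 ↔ ⟪unitNormal f x, v⟫ = 0 := by
  rw [inner_gradient_eq_norm_mul, mul_eq_zero_iff_left (norm_ne_zero_iff.2 hx)]

theorem eventually_gradient_ne_zero (hf : ContDiff ℝ 1 f) (hx : ∇ f x ≠ 0) :
    ∀ᶠ y in 𝓝 x, ∇ f y ≠ 0 :=
  (continuous_gradient hf).continuousAt.eventually_ne hx

theorem contDiffAt_unitNormal (hf : ContDiff ℝ 2 f) (hx : ∇ f x ≠ 0) :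
    ContDiffAt ℝ 1 (unitNormal f) x := by
  have h := (contDiff_gradient hf).contDiffAt (x := x)
  exact ((h.norm ℝ hx).inv (norm_ne_zero_iff.2 hx)).smul h

theorem hasFDerivAt_unitNormal (hf : ContDiff ℝ 2 f) (hx : ∇ f x ≠ 0) :
    HasFDerivAt (unitNormal f) (fderiv ℝ (unitNormal f) x) x :=
  ((contDiffAt_unitNormal hf hx).differentiableAt one_ne_zero).hasFDerivAt

theorem inner_unitNormal_fderiv (hf : ContDiff ℝ 2 f) (hx : ∇ f x ≠ 0) (v : E) :
    ⟪unitNormal f x, fderiv ℝ (unitNormal f) x v⟫ = 0 :=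
  inner_fderiv_eq_zero_of_norm_eq_const (hasFDerivAt_unitNormal hf hx).differentiableAt
    ((eventually_gradient_ne_zero (hf.of_le one_le_two) hx).mono fun _ => norm_unitNormal) v

theorem fderiv_gradient_apply (hf : ContDiff ℝ 2 f) (hx : ∇ f x ≠ 0) (v : E) :
    fderiv ℝ (∇ f) x v = ‖∇ f x‖ • fderiv ℝ (unitNormal f) x v +
      fderiv ℝ (fun y => ‖∇ f y‖) x v • unitNormal f x := by
  have hnorm := ((contDiff_gradient hf).contDiffAt.norm ℝ hx).differentiableAt one_ne_zero
  have hprod : HasFDerivAt (∇ f) _ x :=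
    (hnorm.hasFDerivAt.smul (hasFDerivAt_unitNormal hf hx)).congr_of_eventuallyEq
      (.of_forall fun y => (norm_smul_unitNormal f y).symm)
  simp [hprod.fderiv]

theorem isAligned_unitNormal (f : E → ℝ) (x : E) : IsAligned f x (unitNormal f x) := by
  by_cases hx : ∇ f x = 0
  · simp [IsAligned, hx]
  · rw [IsAligned, inner_gradient_eq_norm_mul, inner_unitNormal_self hx, mul_one,
      norm_smul_unitNormal]

namespace IsAligned

theorem neg (h : IsAligned f x e) : IsAligned f x (-e) := by
  rwa [IsAligned, inner_neg_right, smul_neg, neg_smul, neg_neg]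

theorem of_unitNormal_eq (h : unitNormal f x = e ∨ unitNormal f x = -e) : IsAligned f x e := by
  rcases h with rfl | h
  · exact isAligned_unitNormal f x
  · simpa [h] using (isAligned_unitNormal f x).neg

theorem unitNormal_eq_or (h : IsAligned f x e) (he : ‖e‖ = 1) (hx : ∇ f x ≠ 0) :
    unitNormal f x = e ∨ unitNormal f x = -e := by
  have hne : ⟪∇ f x, e⟫ ≠ 0 := fun h0 => hx (by rw [h, h0, zero_smul])
  rw [unitNormal, h]
  rcases hne.lt_or_gt with hneg | hpos
  · right
    rw [NormedSpace.normalize_smul_of_neg hneg, NormedSpace.normalize_eq_self_of_norm_eq_one he]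
  · left
    rw [NormedSpace.normalize_smul_of_pos hpos, NormedSpace.normalize_eq_self_of_norm_eq_one he]

end IsAligned

theorem isClosed_setOf_isAligned (hf : ContDiff ℝ 1 f) :
    IsClosed {p : E × E | IsAligned f p.1 p.2} := by
  have := continuous_gradient hf
  unfold IsAligned
  exact isClosed_eq (by fun_prop) (by fun_prop)

end UnitNormal

namespace IsMetricFunction

variable {n : ℕ} {f : EuclideanSpace ℝ (Fin n) → ℝ} {x e : EuclideanSpace ℝ (Fin n)}

theorem contDiff_one (hf : IsMetricFunction f) : ContDiff ℝ 1 f :=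
  hf.1.of_le one_le_two

theorem fderiv_norm_gradient_eq_zero (hf : IsMetricFunction f) (hx : ∇ f x ≠ 0)
    {v : EuclideanSpace ℝ (Fin n)} (hv : ⟪unitNormal f x, v⟫ = 0) :
    fderiv ℝ (fun y => ‖∇ f y‖) x v = 0 := by
  obtain ⟨c, rfl, hc, hlevel⟩ :=
    exists_curve_in_levelSurface hf.contDiff_one hx ((inner_gradient_eq_zero_iff hx).2 hv)
  have hnorm := ((contDiff_gradient hf.1).contDiffAt.norm ℝ hx).differentiableAt one_ne_zero
  have hconst : (fun s => ‖∇ f (c s)‖) =ᶠ[𝓝 0] fun _ => ‖∇ f (c 0)‖ :=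
    hlevel.mono fun s hs => hf.2 _ _ hs
  exact (hnorm.hasFDerivAt.comp_hasDerivAt (0 : ℝ) hc).unique
    ((hasDerivAt_const 0 _).congr_of_eventuallyEq hconst)

theorem inner_fderiv_unitNormal_comm (hf : IsMetricFunction f) (hx : ∇ f x ≠ 0)
    (v w : EuclideanSpace ℝ (Fin n)) :
    ⟪fderiv ℝ (unitNormal f) x v, w⟫ = ⟪fderiv ℝ (unitNormal f) x w, v⟫ := by
  set ν := unitNormal f x
  set b := fderiv ℝ (fun y => ‖∇ f y‖) x
  have hb (v : EuclideanSpace ℝ (Fin n)) : b v = ⟪ν, v⟫ * b ν := by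
    have := hf.fderiv_norm_gradient_eq_zero hx (v := v - ⟪ν, v⟫ • ν) (by
      rw [inner_sub_right, inner_smul_right, inner_unitNormal_self hx, mul_one, sub_self])
    rwa [map_sub, map_smul, smul_eq_mul, sub_eq_zero] at this
  have hsymm := inner_fderiv_gradient_comm hf.1 x v w
  simp only [fderiv_gradient_apply hf.1 hx, inner_add_left, real_inner_smul_left] at hsymm
  change _ + b v * ⟪ν, w⟫ = _ + b w * ⟪ν, v⟫ at hsymm
  rw [hb v, hb w] at hsymm
  exact mul_left_cancel₀ (norm_ne_zero_iff.2 hx) (by linarith)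

theorem fderiv_unitNormal_unitNormal (hf : IsMetricFunction f) (hx : ∇ f x ≠ 0) :
    fderiv ℝ (unitNormal f) x (unitNormal f x) = 0 := by
  refine ext_inner_right ℝ fun w => ?_
  rw [hf.inner_fderiv_unitNormal_comm hx, real_inner_comm, inner_unitNormal_fderiv hf.1 hx,
    inner_zero_left]

/-- By Grönwall: `g s = ν (x + s t ν(x)) - ν(x)` vanishes at `0` and satisfies
`g' = -t Dν(x + s t ν(x)) g`, because `Dν` annihilates `ν`. -/
theorem unitNormal_add_smul (hf : IsMetricFunction f) {t : ℝ}
    (hU : ∀ y ∈ segment ℝ x (x + t • unitNormal f x), ∇ f y ≠ 0) :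
    unitNormal f (x + t • unitNormal f x) = unitNormal f x := by
  set ν := unitNormal f
  let c : ℝ → EuclideanSpace ℝ (Fin n) := fun s => x + s • (t • ν x)
  have hc (s : ℝ) : HasDerivAt c (t • ν x) s := hasDerivAt_add_smul x _ s
  have hreg : ∀ s ∈ Icc (0 : ℝ) 1, ∇ f (c s) ≠ 0 := fun s hs => hU _ (by
    rw [segment_eq_image']
    exact ⟨s, hs, by simp [c]⟩)
  have hD : ∀ s ∈ Icc (0 : ℝ) 1,
      HasDerivAt (fun s => ν (c s) - ν x) (fderiv ℝ ν (c s) (t • ν x)) s := fun s hs =>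
    ((hasFDerivAt_unitNormal hf.1 (hreg s hs)).comp_hasDerivAt s (hc s)).sub_const _
  have hcont : ContinuousOn (fun s => ‖t • fderiv ℝ ν (c s)‖) (Icc 0 1) := fun s hs =>
    ((((contDiffAt_unitNormal hf.1 (hreg s hs)).fderiv_right (m := 0) (by simp)).continuousAt.comp
      (hc s).continuousAt).const_smul t).norm.continuousWithinAt
  obtain ⟨M, hM⟩ := isCompact_Icc.bddAbove_image hcont
  have hode : ∀ s ∈ Icc (0 : ℝ) 1,
      fderiv ℝ ν (c s) (t • ν x) = -(t • fderiv ℝ ν (c s)) (ν (c s) - ν x) := fun s hs => by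
    simp [ν, hf.fderiv_unitNormal_unitNormal (hreg s hs)]
  have hzero := eq_zero_of_abs_deriv_le_mul_abs_self_of_eq_zero_right (K := M)
    (fun s hs => (hD s hs).continuousAt.continuousWithinAt)
    (fun s hs => (hD s (Ico_subset_Icc_self hs)).hasDerivWithinAt) (by simp [c]) (fun s hs => by
      rw [hode s (Ico_subset_Icc_self hs), norm_neg]
      exact ContinuousLinearMap.le_of_opNorm_le _ (hM ⟨s, Ico_subset_Icc_self hs, rfl⟩) _)
  simpa [c, sub_eq_zero] using hzero 1 (by simp)

theorem isAligned_add_smul (hf : IsMetricFunction f) {t : ℝ} (he : ‖e‖ = 1) (hx : IsAligned f x e)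
    (hU : ∀ s ∈ Ico (0 : ℝ) t, ∇ f (x + s • e) ≠ 0) :
    ∀ s ∈ Icc (0 : ℝ) t, IsAligned f (x + s • e) e := by
  have hlt : ∀ s ∈ Ico (0 : ℝ) t, IsAligned f (x + s • e) e := by
    intro s hs
    have hx0 : ∇ f x ≠ 0 := by simpa using hU 0 ⟨le_rfl, hs.1.trans_lt hs.2⟩
    have hseg : ∀ y ∈ segment ℝ x (x + s • e), ∇ f y ≠ 0 := by
      rw [segment_eq_image']
      rintro _ ⟨r, hr, rfl⟩
      have := hU (r * s) ⟨mul_nonneg hr.1 hs.1, (mul_le_of_le_one_left hs.1 hr.2).trans_lt hs.2⟩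
      simpa [smul_smul] using this
    rcases hx.unitNormal_eq_or he hx0 with h | h
    · refine .of_unitNormal_eq (.inl ?_)
      rw [← h] at hseg ⊢
      exact hf.unitNormal_add_smul hseg
    · have hline : x + s • e = x + (-s) • unitNormal f x := by rw [h, smul_neg, neg_smul, neg_neg]
      refine .of_unitNormal_eq (.inr ?_)
      rw [hline] at hseg ⊢
      rw [hf.unitNormal_add_smul hseg, h]
  intro s hs
  rcases hs.1.eq_or_lt with rfl | hs0
  · simpa using hx
  have hclosed : IsClosed {r : ℝ | IsAligned f (x + r • e) e} :=
    (isClosed_setOf_isAligned hf.contDiff_one).preimage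
      (show Continuous fun r : ℝ => (x + r • e, e) by fun_prop)
  refine closure_minimal hlt hclosed ?_
  rwa [closure_Ico (hs0.trans_le hs.2).ne]

end IsMetricFunction

section Lipschitz

variable {E : Type*} [NormedAddCommGroup E] [InnerProductSpace ℝ E]

theorem eq_smul_or_neg_smul_of_norm_le_abs_inner {e v : E} (he : ‖e‖ = 1)
    (h : ‖v‖ ≤ |⟪e, v⟫|) : v = ‖v‖ • e ∨ v = -(‖v‖ • e) := by
  rcases eq_or_ne v 0 with rfl | hv
  · simp
  have heq : ‖⟪e, v⟫‖ = ‖e‖ * ‖v‖ :=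
    le_antisymm (norm_inner_le_norm e v) (by simpa [he] using h)
  obtain ⟨r, -, rfl⟩ := (norm_inner_eq_norm_iff (norm_ne_zero_iff.1 (by simp [he])) hv).1 heq
  rw [norm_smul, he, mul_one, Real.norm_eq_abs, ← neg_smul]
  rcases abs_choice r with hr | hr <;> simp [hr]

/-- A `1`-Lipschitz function which grows at unit speed between `x` and `z` does so along the whole
segment, so that its derivative at `x` in the direction of `z` is extremal. -/
theorem eq_add_or_sub_smul_of_norm_le_abs_sub [CompleteSpace E] {u : E → ℝ} {x z e : E}
    (hu : LipschitzWith 1 u) (he : ‖e‖ = 1) (hgrad : HasGradientAt u e x)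
    (h : ‖z - x‖ ≤ |u z - u x|) : z = x + ‖z - x‖ • e ∨ z = x - ‖z - x‖ • e := by
  have hlip (a b : E) : |u a - u b| ≤ ‖a - b‖ := by
    simpa [Real.dist_eq, dist_eq_norm] using hu.dist_le_mul a b
  have hspeed : ∀ t ∈ Ioc (0 : ℝ) 1, t * ‖z - x‖ ≤ |u (x + t • (z - x)) - u x| := fun t ht => by
    have hrest := hlip z (x + t • (z - x))
    rw [show z - (x + t • (z - x)) = (1 - t) • (z - x) by module, norm_smul,
      Real.norm_of_nonneg (sub_nonneg.2 ht.2)] at hrest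
    linarith [abs_sub_le (u z) (u (x + t • (z - x))) (u x)]
  have hderiv : HasDerivAt (fun t : ℝ => u (x + t • (z - x))) ⟪e, z - x⟫ 0 := by
    have hline := hasDerivAt_add_smul x (z - x) 0
    have hgrad' : HasGradientAt u e (x + (0 : ℝ) • (z - x)) := by simpa using hgrad
    simpa [Function.comp_def] using hgrad'.hasFDerivAt.comp_hasDerivAt (0 : ℝ) hline
  have hslope := (hderiv.tendsto_slope_zero_right).abs
  have hle : ‖z - x‖ ≤ |⟪e, z - x⟫| := by
    refine ge_of_tendsto hslope ?_
    filter_upwards [Ioc_mem_nhdsGT one_pos] with t ht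
    have := hspeed t ht
    simp only [zero_add, zero_smul, add_zero, smul_eq_mul, abs_mul, abs_inv, abs_of_pos ht.1]
    rwa [inv_mul_eq_div, le_div_iff₀' ht.1]
  refine (eq_smul_or_neg_smul_of_norm_le_abs_inner he hle).imp (fun h => ?_) fun h => ?_
  · rw [← h, add_sub_cancel]
  · rw [sub_eq_add_neg, ← h, add_sub_cancel]

end Lipschitz

section Potential

variable {n : ℕ} {f u : EuclideanSpace ℝ (Fin n) → ℝ} {s : Set (EuclideanSpace ℝ (Fin n))}
  {a x z : EuclideanSpace ℝ (Fin n)} {d t : ℝ}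

/-- The unit normal field of `f` is the gradient of `u` on `s`: the function `u` measures the signed
distance between level surfaces of `f`. -/
def IsNormalPotential (f u : EuclideanSpace ℝ (Fin n) → ℝ) (s : Set (EuclideanSpace ℝ (Fin n))) :
    Prop :=
  ∀ a ∈ s, HasGradientAt u (unitNormal f a) a

theorem IsMetricFunction.exists_isNormalPotential (hf : IsMetricFunction f) (hs : IsOpen s)
    (hconv : Convex ℝ s) (hreg : ∀ a ∈ s, ∇ f a ≠ 0) : ∃ u, IsNormalPotential f u s := by
  have hD : ∀ a ∈ s, HasFDerivAt (fun a => innerSL ℝ (unitNormal f a))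
      ((innerSL ℝ).comp (fderiv ℝ (unitNormal f) a)) a := fun a ha =>
    (innerSL ℝ (E := EuclideanSpace ℝ (Fin n))).hasFDerivAt.comp a
      (hasFDerivAt_unitNormal hf.1 (hreg a ha))
  refine hconv.exists_forall_hasFDerivAt_of_fderiv_symmetric hs
    (fun a ha => (hD a ha).differentiableAt.differentiableWithinAt) fun a ha v w => ?_
  change fderiv ℝ (fun a => innerSL ℝ (unitNormal f a)) a v w =
    fderiv ℝ (fun a => innerSL ℝ (unitNormal f a)) a w v
  rw [(hD a ha).fderiv]
  exact hf.inner_fderiv_unitNormal_comm (hreg a ha) v w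

namespace IsNormalPotential

theorem lipschitzOnWith (hu : IsNormalPotential f u s) (hconv : Convex ℝ s)
    (hreg : ∀ a ∈ s, ∇ f a ≠ 0) : LipschitzOnWith 1 u s :=
  hconv.lipschitzOnWith_of_nnnorm_hasFDerivWithin_le
    (fun a ha => (hu a ha).hasFDerivAt.hasFDerivWithinAt) fun a ha => by
      rw [LinearIsometryEquiv.nnnorm_map, ← NNReal.coe_le_coe, coe_nnnorm,
        norm_unitNormal (hreg a ha), NNReal.coe_one]

theorem apply_add_smul (hu : IsNormalPotential f u s) (hf : IsMetricFunction f)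
    (hconv : Convex ℝ s) (hreg : ∀ a ∈ s, ∇ f a ≠ 0) (ha : a ∈ s)
    (hat : a + t • unitNormal f a ∈ s) : u (a + t • unitNormal f a) = u a + t := by
  obtain ⟨c, hc, hmvt⟩ := domain_mvt (fun a ha => (hu a ha).hasFDerivAt.hasFDerivWithinAt)
    hconv ha hat
  obtain ⟨r, -, rfl⟩ : c ∈ (fun r => a + r • (a + t • unitNormal f a - a)) '' Icc (0 : ℝ) 1 := by
    rwa [← segment_eq_image']
  have hν : unitNormal f (a + (r * t) • unitNormal f a) = unitNormal f a :=
    hf.unitNormal_add_smul fun y hy => hreg y (hconv.segment_subset ha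
      (by simpa [smul_smul] using hconv.segment_subset ha hat hc) hy)
  simp only [add_sub_cancel_left, smul_smul, hν] at hmvt
  rw [sub_eq_iff_eq_add'.1 hmvt, InnerProductSpace.toDual_apply_apply, inner_smul_right,
    inner_unitNormal_self (hreg a ha), mul_one]

theorem mem_levelSurface_of_curve (hu : IsNormalPotential f u s) (hf : ContDiff ℝ 1 f)
    (hreg : ∀ a ∈ s, ∇ f a ≠ 0) {c : ℝ → EuclideanSpace ℝ (Fin n)} {r : ℝ}
    (hc : ∀ t ∈ Icc (0 : ℝ) 1, DifferentiableAt ℝ c t) (hcs : ∀ t ∈ Icc (0 : ℝ) 1, c t ∈ s)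
    (hcr : ∀ t ∈ Icc (0 : ℝ) 1, u (c t) = r) : c 1 ∈ levelSurface f (c 0) := by
  have hcont : ContinuousOn c (Icc 0 1) := fun t ht => (hc t ht).continuousAt.continuousWithinAt
  have hperp : ∀ t ∈ Ico (0 : ℝ) 1, ⟪unitNormal f (c t), deriv c t⟫ = 0 := by
    intro t ht
    have ht' := Ico_subset_Icc_self ht
    have hcomp := (hu _ (hcs t ht')).hasFDerivAt.comp_hasDerivAt t (hc t ht').hasDerivAt
    have hconst : HasDerivWithinAt (u ∘ c) 0 (Ici t) t := by
      refine (hasDerivWithinAt_const t (Ici t) r).congr_of_eventuallyEq ?_ (hcr t ht')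
      filter_upwards [Icc_mem_nhdsGE ht.2] with t' h
      exact hcr t' ⟨ht.1.trans h.1, h.2⟩
    simpa using (uniqueDiffWithinAt_Ici t).eq_deriv _ hcomp.hasDerivWithinAt hconst
  have hfc : ∀ t ∈ Icc (0 : ℝ) 1, f (c t) = f (c 0) := by
    refine constant_of_has_deriv_right_zero (hf.continuous.comp_continuousOn hcont) fun t ht => ?_
    have ht' := Ico_subset_Icc_self ht
    have hcomp := hasDerivAt_comp_of_differentiable (hf.differentiable one_ne_zero)
      (hc t ht').hasDerivAt
    rw [(inner_gradient_eq_zero_iff (hreg _ (hcs t ht'))).2 (hperp t ht)] at hcomp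
    exact hcomp.hasDerivWithinAt
  exact subset_levelSurface (isPreconnected_Icc.image c hcont) ⟨0, by simp, rfl⟩
    (by rintro _ ⟨t, ht, rfl⟩; exact hfc t ht) ⟨1, by simp, rfl⟩

/-- Move `y` along the segment from `x` to `a`: the point of height `u a` on the normal line
through `y` stays in the ball and moves in one level surface, from the normal line of `x` to `a`. -/
theorem norm_gradient_eq (hu : IsNormalPotential f u (ball x d)) (hf : IsMetricFunction f)
    (hreg : ∀ a ∈ ball x d, ∇ f a ≠ 0) (ha : a ∈ ball x d) :
    ‖∇ f a‖ = ‖∇ f (x + (u a - u x) • unitNormal f x)‖ := by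
  have hx : x ∈ ball x d := mem_ball_self (dist_nonneg.trans_lt ha)
  have hconv := convex_ball x d
  let y : ℝ → EuclideanSpace ℝ (Fin n) := fun t => x + t • (a - x)
  let c : ℝ → EuclideanSpace ℝ (Fin n) := fun t => y t + (u a - u (y t)) • unitNormal f (y t)
  have hy : ∀ t ∈ Icc (0 : ℝ) 1, y t ∈ ball x d := fun t ht => hconv.add_smul_sub_mem hx ha ht
  have hc : ∀ t ∈ Icc (0 : ℝ) 1, c t ∈ ball x d := by
    intro t ht
    have hlip := (hu.lipschitzOnWith hconv hreg).dist_le_mul a ha (y t) (hy t ht)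
    rw [NNReal.coe_one, one_mul, Real.dist_eq, dist_eq_norm,
      show a - y t = (1 - t) • (a - x) by simp only [y]; module, norm_smul,
      Real.norm_of_nonneg (sub_nonneg.2 ht.2)] at hlip
    have htri := norm_add_le (t • (a - x)) ((u a - u (y t)) • unitNormal f (y t))
    rw [norm_smul, norm_smul, norm_unitNormal (hreg _ (hy t ht)), Real.norm_of_nonneg ht.1,
      Real.norm_eq_abs] at htri
    rw [mem_ball_iff_norm] at ha ⊢
    calc ‖c t - x‖ = ‖t • (a - x) + (u a - u (y t)) • unitNormal f (y t)‖ := by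
          congr 1; simp only [c, y]; module
      _ ≤ ‖a - x‖ := by linarith
      _ < d := ha
  have hdiff : ∀ t ∈ Icc (0 : ℝ) 1, DifferentiableAt ℝ c t := by
    intro t ht
    have hyt : DifferentiableAt ℝ y t := (hasDerivAt_add_smul x (a - x) t).differentiableAt
    have hνt : DifferentiableAt ℝ (fun t => unitNormal f (y t)) t :=
      (hasFDerivAt_unitNormal hf.1 (hreg _ (hy t ht))).differentiableAt.comp t hyt
    have hut : DifferentiableAt ℝ (fun t => u (y t)) t :=
      (hu _ (hy t ht)).hasFDerivAt.differentiableAt.comp t hyt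
    exact hyt.add ((hut.const_sub _).smul hνt)
  have hlevel := hu.mem_levelSurface_of_curve hf.contDiff_one hreg hdiff hc (r := u a)
    fun t ht => by
      rw [hu.apply_add_smul hf hconv hreg (hy t ht) (hc t ht), add_sub_cancel]
  simpa [c, y] using hf.2 _ _ hlevel

end IsNormalPotential

theorem IsMetricFunction.eq_add_or_sub_smul_unitNormal_of_nearest (hf : IsMetricFunction f)
    (hreg : ∀ a ∈ ball x ‖z - x‖, ∇ f a ≠ 0) (hz : ∇ f z = 0) :
    z = x + ‖z - x‖ • unitNormal f x ∨ z = x - ‖z - x‖ • unitNormal f x := by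
  rcases eq_or_ne z x with rfl | hne
  · simp
  have hd : 0 < ‖z - x‖ := norm_sub_pos_iff.2 hne
  have hx : x ∈ ball x ‖z - x‖ := mem_ball_self hd
  obtain ⟨v, hv⟩ := hf.exists_isNormalPotential isOpen_ball (convex_ball x _) hreg
  obtain ⟨u, hlip, heq⟩ := (hv.lipschitzOnWith (convex_ball x _) hreg).extend_real
  have hclosed : IsClosed {a | ‖∇ f a‖ = ‖∇ f (x + (u a - u x) • unitNormal f x)‖} := by
    have := continuous_gradient hf.contDiff_one
    have := hlip.continuous
    exact isClosed_eq (by fun_prop) (by fun_prop)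
  have hend : ∇ f (x + (u z - u x) • unitNormal f x) = 0 := by
    have hsub : closure (ball x ‖z - x‖) ⊆ _ := closure_minimal (fun a ha => by
      rw [mem_ofPred_eq, ← heq ha, ← heq hx, hv.norm_gradient_eq hf hreg ha]) hclosed
    rw [closure_ball x hd.ne'] at hsub
    have hmem : ‖∇ f z‖ = _ := hsub (mem_closedBall_iff_norm.2 le_rfl)
    rwa [hz, norm_zero, eq_comm, norm_eq_zero] at hmem
  have hfar : ‖z - x‖ ≤ |u z - u x| := by
    by_contra! hlt
    refine hreg _ ?_ hend
    rwa [mem_ball_iff_norm, add_sub_cancel_left, norm_smul, norm_unitNormal (hreg x hx), mul_one]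
  exact eq_add_or_sub_smul_of_norm_le_abs_sub hlip (norm_unitNormal (hreg x hx))
    ((hv x hx).hasFDerivAt.congr_of_eventuallyEq
      ((heq.eventuallyEq_of_mem (isOpen_ball.mem_nhds hx)).symm)) hfar

end Potential

section NormalSpace

variable {E : Type*} [NormedAddCommGroup E] [InnerProductSpace ℝ E] {S : Set E} {w m v : E}

/-- The normal space of a set `S` at `w`: the vectors orthogonal to `S` at first order. For an
embedded submanifold this is the orthogonal complement of the tangent space. -/
def normalSpace (S : Set E) (w : E) : Submodule ℝ E where
  carrier := {m | (fun z => ⟪m, z - w⟫) =o[𝓝[S] w] fun z => z - w}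
  add_mem' ha hb := by
    simp only [mem_ofPred_eq, inner_add_left] at *
    exact ha.add hb
  zero_mem' := by simp
  smul_mem' c a ha := by
    simp only [mem_ofPred_eq, real_inner_smul_left] at *
    exact ha.const_mul_left _

theorem mem_normalSpace_iff :
    m ∈ normalSpace S w ↔ (fun z => ⟪m, z - w⟫) =o[𝓝[S] w] fun z => z - w :=
  Iff.rfl

theorem normalSpace_congr {S' : Set E} (h : 𝓝[S] w = 𝓝[S'] w) :
    normalSpace S w = normalSpace S' w := by
  ext m
  rw [mem_normalSpace_iff, mem_normalSpace_iff, h]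

theorem inner_eq_zero_of_mem_normalSpace {c : ℝ → E} (hm : m ∈ normalSpace S (c 0))
    (hc : HasDerivAt c v 0) (hS : ∀ᶠ s in 𝓝 0, c s ∈ S) : ⟪m, v⟫ = 0 := by
  have hlim : Tendsto c (𝓝 0) (𝓝[S] c 0) :=
    tendsto_nhdsWithin_iff.2 ⟨hc.continuousAt.tendsto, hS⟩
  have ho : (fun s => ⟪m, c s - c 0⟫) =o[𝓝 0] fun s : ℝ => s - 0 :=
    ((mem_normalSpace_iff.1 hm).comp_tendsto hlim).trans_isBigO hc.isBigO_sub
  have hzero : HasDerivAt (fun s => ⟪m, c s⟫) 0 0 := by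
    rw [hasDerivAt_iff_isLittleO]
    exact ho.congr_left fun s => by simp [inner_sub_right]
  exact ((innerSL ℝ m).hasFDerivAt.comp_hasDerivAt (0 : ℝ) hc).unique hzero

/-- The points `z s` of `S` are no farther from `w + s m` than `w` is: since `m` is normal, they
approach `w` faster than `w + s m`. -/
theorem isLittleO_sub_of_mem_normalSpace (hm : m ∈ normalSpace S w) (hm1 : ‖m‖ = 1) {z : ℝ → E}
    (hzS : ∀ᶠ s in 𝓝[>] 0, z s ∈ S) (hz : ∀ᶠ s in 𝓝[>] 0, ‖w + s • m - z s‖ ≤ s) :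
    (fun s => z s - w) =o[𝓝[>] 0] fun s => s := by
  have hle : ∀ᶠ s in 𝓝[>] (0 : ℝ), ‖z s - w‖ ≤ 2 * s := by
    filter_upwards [hz, self_mem_nhdsWithin] with s hs (hs0 : 0 < s)
    rw [show z s - w = s • m - (w + s • m - z s) by module]
    refine (norm_sub_le _ _).trans ?_
    rw [norm_smul, hm1, Real.norm_of_nonneg hs0.le]
    linarith
  have hlim : Tendsto z (𝓝[>] 0) (𝓝[S] w) := by
    refine tendsto_nhdsWithin_iff.2 ⟨tendsto_iff_norm_sub_tendsto_zero.2 ?_, hzS⟩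
    refine squeeze_zero' (.of_forall fun s => norm_nonneg _) hle ?_
    exact ((continuous_const_mul 2).tendsto' (0 : ℝ) 0 (by simp)).mono_left nhdsWithin_le_nhds
  refine IsLittleO.of_bound fun ε hε => ?_
  filter_upwards [((mem_normalSpace_iff.1 hm).comp_tendsto hlim).bound (half_pos hε), hz,
    self_mem_nhdsWithin] with s hs hzs (hs0 : 0 < s)
  have hsq : ‖z s - w‖ ^ 2 ≤ 2 * s * ⟪m, z s - w⟫ := by
    have := pow_le_pow_left₀ (norm_nonneg _) hzs 2
    rw [show w + s • m - z s = s • m - (z s - w) by module, norm_sub_sq_real, norm_smul, hm1,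
      real_inner_smul_left, Real.norm_of_nonneg hs0.le] at this
    linarith
  have hinner : ⟪m, z s - w⟫ ≤ ε / 2 * ‖z s - w‖ := (le_abs_self _).trans hs
  rw [Real.norm_of_nonneg hs0.le]
  by_contra! hlt
  nlinarith [norm_nonneg (z s - w), mul_pos hε hs0]

theorem eventually_add_smul_notMem_of_mem_normalSpace (hm : m ∈ normalSpace S w)
    (hm1 : ‖m‖ = 1) : ∀ᶠ s in 𝓝[>] (0 : ℝ), w + s • m ∉ S := by
  have hlim : Tendsto (fun s : ℝ => w + s • m) (𝓝[>] 0) (𝓝 w) :=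
    ((by fun_prop : Continuous fun s : ℝ => w + s • m).tendsto' 0 w (by simp)).mono_left
      nhdsWithin_le_nhds
  have hbound := eventually_nhdsWithin_iff.1
    ((mem_normalSpace_iff.1 hm).bound (c := 1 / 2) (by norm_num))
  filter_upwards [hlim.eventually hbound, self_mem_nhdsWithin] with s hs (hs0 : 0 < s) hsS
  have := hs hsS
  rw [add_sub_cancel_left, inner_smul_right, real_inner_self_eq_norm_sq, norm_smul, hm1,
    one_pow, mul_one, mul_one, Real.norm_of_nonneg hs0.le] at this
  linarith

end NormalSpace

section RegularSurface

variable {n r : ℕ} {S : Set (EuclideanSpace ℝ (Fin n))} {w v x p : EuclideanSpace ℝ (Fin n)}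

theorem mem_planeThrough {W : Submodule ℝ (EuclideanSpace ℝ (Fin n))} :
    x ∈ planeThrough p W ↔ x - p ∈ W :=
  ⟨fun ⟨w, hw, h⟩ => by simpa [h] using hw, fun h => ⟨x - p, h, by simp⟩⟩

theorem planeThrough_bot (p : EuclideanSpace ℝ (Fin n)) : planeThrough p ⊥ = {p} := by
  ext x
  simp [mem_planeThrough, sub_eq_zero]

theorem isRegularSurface_planeThrough (p : EuclideanSpace ℝ (Fin n))
    (W : Submodule ℝ (EuclideanSpace ℝ (Fin n))) (m : WithTop ℕ∞) :
    IsRegularSurface m (Module.finrank ℝ W) (planeThrough p W) := by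
  intro q _
  refine ⟨(Homeomorph.addRight (-p)).toOpenPartialHomeomorph, W, by simp,
    (contDiff_id.add contDiff_const).contDiffOn, (contDiff_id.add contDiff_const).contDiffOn,
    rfl, fun x _ => ?_⟩
  simp [mem_planeThrough, ← sub_eq_add_neg]

namespace IsRegularSurface

theorem exists_linearized_chart (hS : IsRegularSurface 1 r S) (hw : w ∈ S) :
    ∃ (Φ : OpenPartialHomeomorph (EuclideanSpace ℝ (Fin n)) (EuclideanSpace ℝ (Fin n)))
      (A : EuclideanSpace ℝ (Fin n) ≃L[ℝ] EuclideanSpace ℝ (Fin n))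
      (W : Submodule ℝ (EuclideanSpace ℝ (Fin n))),
      w ∈ Φ.source ∧ HasFDerivAt Φ (A : EuclideanSpace ℝ (Fin n) →L[ℝ] _) w ∧
        HasFDerivAt Φ.symm (A.symm : EuclideanSpace ℝ (Fin n) →L[ℝ] _) (Φ w) ∧
        Module.finrank ℝ W = r ∧ ∀ x ∈ Φ.source, x ∈ S ↔ Φ x ∈ W := by
  obtain ⟨Φ, W, hsource, hΦ, hΦs, hW, hmem⟩ := hS w hw
  have htarget := Φ.map_source hsource
  have hA := ((hΦ.contDiffAt (Φ.open_source.mem_nhds hsource)).differentiableAt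
    one_ne_zero).hasFDerivAt
  have hB := ((hΦs.contDiffAt (Φ.open_target.mem_nhds htarget)).differentiableAt
    one_ne_zero).hasFDerivAt
  have hBA := (hB.comp w hA).unique ((hasFDerivAt_id w).congr_of_eventuallyEq
    (Φ.eventually_left_inverse hsource))
  have hA' : HasFDerivAt Φ (fderiv ℝ Φ w) (Φ.symm (Φ w)) := by rwa [Φ.left_inv hsource]
  have hAB := (hA'.comp (Φ w) hB).unique ((hasFDerivAt_id (Φ w)).congr_of_eventuallyEq
    (Φ.eventually_right_inverse htarget))
  exact ⟨Φ, .equivOfInverse (fderiv ℝ Φ w) (fderiv ℝ Φ.symm (Φ w))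
    (fun v => congrArg (fun L => L v) hBA) (fun v => congrArg (fun L => L v) hAB), W, hsource,
    hA, hB, hW, hmem⟩

theorem exists_tangentSpace (hS : IsRegularSurface 1 r S) (hw : w ∈ S) :
    ∃ T : Submodule ℝ (EuclideanSpace ℝ (Fin n)), Module.finrank ℝ T = r ∧
      normalSpace S w = Tᗮ ∧ ∀ v ∈ T, ∃ c : ℝ → EuclideanSpace ℝ (Fin n), c 0 = w ∧
        HasDerivAt c v 0 ∧ ∀ᶠ s in 𝓝 0, c s ∈ S := by
  obtain ⟨Φ, A, W, hsource, hA, hB, hW, hmem⟩ := hS.exists_linearized_chart hw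
  have hΦw := (hmem w hsource).1 hw
  have hcurve : ∀ v ∈ W.map A.symm.toLinearEquiv.toLinearMap,
      ∃ c : ℝ → EuclideanSpace ℝ (Fin n), c 0 = w ∧ HasDerivAt c v 0 ∧ ∀ᶠ s in 𝓝 0, c s ∈ S := by
    rintro _ ⟨k, hk, rfl⟩
    have hB' : HasFDerivAt Φ.symm (A.symm : EuclideanSpace ℝ (Fin n) →L[ℝ]
        EuclideanSpace ℝ (Fin n)) (Φ w + (0 : ℝ) • k) := by simpa using hB
    have hcomp := hB'.comp_hasDerivAt (0 : ℝ) (hasDerivAt_add_smul (Φ w) k 0)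
    refine ⟨fun s => Φ.symm (Φ w + s • k), by simp [Φ.left_inv hsource], hcomp, ?_⟩
    have hline : Tendsto (fun s : ℝ => Φ w + s • k) (𝓝 0) (𝓝 (Φ w)) :=
      (by fun_prop : Continuous fun s : ℝ => Φ w + s • k).tendsto' 0 _ (by simp)
    filter_upwards [hline.eventually (Φ.open_target.mem_nhds (Φ.map_source hsource))] with s hs
    rw [hmem _ (Φ.map_target hs), Φ.right_inv hs]
    exact W.add_mem hΦw (W.smul_mem s hk)
  refine ⟨W.map A.symm.toLinearEquiv.toLinearMap, ?_, le_antisymm ?_ ?_, hcurve⟩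
  · rw [← hW]
    exact LinearEquiv.finrank_map_eq A.symm.toLinearEquiv W
  · intro m hm
    rw [Submodule.mem_orthogonal']
    intro v hv
    obtain ⟨c, rfl, hc, hcS⟩ := hcurve v hv
    exact inner_eq_zero_of_mem_normalSpace hm hc hcS
  · intro m hm
    have hrem : (fun z => ⟪m, A.symm (Φ z - Φ w - A (z - w))⟫) =o[𝓝[S] w] fun z => z - w :=
      (((innerSL ℝ m).comp (A.symm : EuclideanSpace ℝ (Fin n) →L[ℝ]
        EuclideanSpace ℝ (Fin n))).isBigO_comp _ _).trans_isLittleO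
        (hA.isLittleO.mono nhdsWithin_le_nhds)
    refine mem_normalSpace_iff.2 (hrem.neg_left.congr' ?_ .rfl)
    filter_upwards [self_mem_nhdsWithin,
      mem_nhdsWithin_of_mem_nhds (Φ.open_source.mem_nhds hsource)] with z hzS hz
    have horth := (Submodule.mem_orthogonal' _ _).1 hm _
      (Submodule.mem_map_of_mem (W.sub_mem ((hmem z hz).1 hzS) hΦw))
    simp only [LinearEquiv.coe_coe, ContinuousLinearEquiv.coe_toLinearEquiv] at horth
    rw [map_sub, A.symm_apply_apply, inner_sub_right, horth, zero_sub, neg_neg]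

theorem finrank_normalSpace (hS : IsRegularSurface 1 r S) (hw : w ∈ S) :
    r + Module.finrank ℝ (normalSpace S w) = n := by
  obtain ⟨T, hT, hN, -⟩ := hS.exists_tangentSpace hw
  rw [hN, ← hT, Submodule.finrank_add_finrank_orthogonal, finrank_euclideanSpace_fin]

theorem exists_curve (hS : IsRegularSurface 1 r S) (hw : w ∈ S) (hv : v ∈ (normalSpace S w)ᗮ) :
    ∃ c : ℝ → EuclideanSpace ℝ (Fin n), c 0 = w ∧ HasDerivAt c v 0 ∧ ∀ᶠ s in 𝓝 0, c s ∈ S := by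
  obtain ⟨T, -, hN, hc⟩ := hS.exists_tangentSpace hw
  rw [hN, Submodule.orthogonal_orthogonal] at hv
  exact hc v hv

theorem sub_mem_normalSpace_of_nearest (hS : IsRegularSurface 1 r S) (hw : w ∈ S)
    (h : ∀ z ∈ S, ‖x - w‖ ≤ ‖x - z‖) : x - w ∈ normalSpace S w := by
  rw [← (normalSpace S w).orthogonal_orthogonal, Submodule.mem_orthogonal']
  intro v hv
  obtain ⟨c, rfl, hc, hcS⟩ := hS.exists_curve hw hv
  have hmin : IsLocalMin (fun s => ‖x - c s‖ ^ 2) 0 :=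
    hcS.mono fun s hs => pow_le_pow_left₀ (norm_nonneg _) (h _ hs) 2
  have hderiv := hmin.hasDerivAt_eq_zero (hc.const_sub x).norm_sq
  rw [inner_neg_right] at hderiv
  linarith

theorem eq_of_gradient_eq_zero {k : EuclideanSpace ℝ (Fin n) → ℝ} (hS : IsRegularSurface 1 r S)
    (hconn : IsPreconnected S) (hk : Differentiable ℝ k) (hcrit : ∀ z ∈ S, ∇ k z = 0)
    (hx : x ∈ S) (hw : w ∈ S) : k x = k w := by
  refine hconn.induction₂ (fun a b => k a = k b) (fun a ha => ?_)
    (fun _ _ _ _ _ _ => Eq.trans) (fun _ _ _ _ => Eq.symm) hx hw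
  obtain ⟨Φ, W, hsource, -, hΦs, -, hmem⟩ := hS a ha
  obtain ⟨ρ, hρ, hball⟩ := Metric.isOpen_iff.1 Φ.open_target _ (Φ.map_source hsource)
  have hderiv : ∀ q ∈ ball (Φ a) ρ ∩ W, HasFDerivAt (k ∘ Φ.symm) 0 q := fun q hq => by
    have hΦq := ((hΦs.contDiffAt (Φ.open_target.mem_nhds (hball hq.1))).differentiableAt
      one_ne_zero).hasFDerivAt
    have hcomp := (hk (Φ.symm q)).hasGradientAt.hasFDerivAt.comp q hΦq
    rwa [hcrit _ (by rw [hmem _ (Φ.map_target (hball hq.1)), Φ.right_inv (hball hq.1)]; exact hq.2),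
      map_zero, ContinuousLinearMap.zero_comp] at hcomp
  filter_upwards [self_mem_nhdsWithin, mem_nhdsWithin_of_mem_nhds (Φ.open_source.mem_nhds hsource),
    mem_nhdsWithin_of_mem_nhds ((Φ.continuousAt hsource).preimage_mem_nhds (ball_mem_nhds _ hρ))]
    with y hyS hy hyball
  have hle := ((convex_ball (Φ a) ρ).inter W.convex).norm_image_sub_le_of_norm_hasFDerivWithin_le
    (C := 0) (fun q hq => (hderiv q hq).hasFDerivWithinAt) (fun q _ => by simp)
    ⟨hyball, (hmem y hy).1 hyS⟩ ⟨mem_ball_self hρ, (hmem a hsource).1 ha⟩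
  rw [zero_mul, norm_le_zero_iff, sub_eq_zero] at hle
  simpa [Φ.left_inv hsource, Φ.left_inv hy] using hle

end IsRegularSurface

end RegularSurface

section NormalSegment

variable {n : ℕ} {f : EuclideanSpace ℝ (Fin n) → ℝ} {w x z e m : EuclideanSpace ℝ (Fin n)}

theorem isClosed_criticalSet (hf : ContDiff ℝ 1 f) : IsClosed (criticalSet f) :=
  isClosed_singleton.preimage (continuous_gradient hf)

theorem exists_first_zero {E : Type*} [TopologicalSpace E] [T1Space E] [Zero E] {g : ℝ → E}
    {a b : ℝ} (hg : Continuous g) (hab : a ≤ b) (hb : g b = 0) :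
    ∃ c ∈ Icc a b, g c = 0 ∧ ∀ s ∈ Ico a c, g s ≠ 0 := by
  have hcompact : IsCompact (Icc a b ∩ g ⁻¹' {0}) :=
    isCompact_Icc.inter_right (isClosed_singleton.preimage hg)
  obtain ⟨c, ⟨hc, hc0⟩, hleast⟩ := hcompact.exists_isLeast ⟨b, right_mem_Icc.2 hab, hb⟩
  exact ⟨c, hc, hc0, fun s hs hs0 =>
    (hleast ⟨⟨hs.1, hs.2.le.trans hc.2⟩, hs0⟩).not_gt hs.2⟩

theorem exists_nearest_critical (hf : ContDiff ℝ 1 f) (hz : ∇ f z = 0)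
    (x : EuclideanSpace ℝ (Fin n)) :
    ∃ w, ∇ f w = 0 ∧ ∀ q, ∇ f q = 0 → ‖x - w‖ ≤ ‖x - q‖ := by
  obtain ⟨w, hw, hdist⟩ := (isClosed_criticalSet hf).exists_infDist_eq_dist ⟨z, hz⟩ x
  refine ⟨w, hw, fun q hq => ?_⟩
  rw [← dist_eq_norm, ← dist_eq_norm, ← hdist]
  exact infDist_le_dist_of_mem hq

namespace IsMetricFunction

theorem isAligned_of_Ioo (hf : IsMetricFunction f) (he : ‖e‖ = 1) {a b c : ℝ} (hc : c ∈ Ioo a b)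
    (hal : IsAligned f (x + c • e) e) (hreg : ∀ s ∈ Ioo a b, ∇ f (x + s • e) ≠ 0) :
    ∀ s ∈ Icc a b, IsAligned f (x + s • e) e := by
  intro s hs
  rcases le_total c s with hcs | hsc
  · have := hf.isAligned_add_smul (t := s - c) he hal (fun τ hτ => by
      rw [add_assoc, ← add_smul]
      exact hreg _ ⟨by linarith [hτ.1, hc.1], by linarith [hτ.2, hs.2]⟩) _
      ⟨sub_nonneg.2 hcs, le_rfl⟩
    rwa [add_assoc, ← add_smul, add_sub_cancel] at this
  · have := hf.isAligned_add_smul (t := c - s) (by rwa [norm_neg]) hal.neg (fun τ hτ => by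
      rw [show x + c • e + τ • -e = x + (c - τ) • e by module]
      exact hreg _ ⟨by linarith [hτ.2, hs.1], by linarith [hτ.1, hc.2]⟩) _
      ⟨sub_nonneg.2 hsc, le_rfl⟩
    rw [show x + c • e + (c - s) • -e = x + s • e by module] at this
    simpa using this.neg

theorem gradient_ne_zero_of_mem_ball (hf : IsMetricFunction f) (he : ‖e‖ = 1)
    (hal : IsAligned f x e) {ρ : ℝ} (hreg : ∀ s ∈ Ioo (-ρ) ρ, ∇ f (x + s • e) ≠ 0)
    (hz : z ∈ ball x ρ) : ∇ f z ≠ 0 := by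
  intro hz0
  obtain ⟨w, hw, hmin⟩ := exists_nearest_critical hf.contDiff_one hz0 x
  have hd : ‖w - x‖ < ρ := by
    rw [norm_sub_rev]
    exact (hmin z hz0).trans_lt (mem_ball_iff_norm'.1 hz)
  have hx : ∇ f x ≠ 0 := by
    have hρ := (norm_nonneg _).trans_lt hd
    simpa using hreg 0 ⟨neg_neg_iff_pos.2 hρ, hρ⟩
  have hfree : ∀ a ∈ ball x ‖w - x‖, ∇ f a ≠ 0 := fun a ha ha0 => by
    rw [mem_ball_iff_norm', norm_sub_rev w x] at ha
    exact (hmin a ha0).not_gt ha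
  have hplus := hreg ‖w - x‖ ⟨by linarith [norm_nonneg (w - x)], hd⟩
  have hminus := hreg (-‖w - x‖) ⟨neg_lt_neg hd, by linarith [norm_nonneg (w - x)]⟩
  rw [neg_smul, ← sub_eq_add_neg] at hminus
  suffices hw' : w = x + ‖w - x‖ • e ∨ w = x - ‖w - x‖ • e by
    rcases hw' with hw' | hw'
    · exact hplus (by rwa [← hw'])
    · exact hminus (by rwa [← hw'])
  have hnearest := hf.eq_add_or_sub_smul_unitNormal_of_nearest hfree hw
  rcases hal.unitNormal_eq_or he hx with h | h
  · rwa [h] at hnearest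
  · rwa [h, smul_neg, sub_neg_eq_add, ← sub_eq_add_neg, or_comm] at hnearest

/-- If a further critical point existed on the ray, then by Rolle's theorem the slope of `f` would
vanish between `z` and the first one. -/
theorem gradient_ne_zero_and_isAligned_of_ray (hf : IsMetricFunction f) (he : ‖e‖ = 1) {d R : ℝ}
    (hd : d ∈ Ioo 0 R) (hreg : ∀ s ∈ Ioc 0 d, ∇ f (z + s • e) ≠ 0)
    (hal : IsAligned f (z + d • e) e)
    (hval : ∀ s ∈ Ioo 0 R, ∇ f (z + s • e) = 0 → f (z + s • e) = f z) {ρ : ℝ} (hρ : ρ ∈ Ioo 0 R) :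
    ∇ f (z + ρ • e) ≠ 0 ∧ IsAligned f (z + ρ • e) e := by
  have hfree : ∀ s ∈ Ioo 0 R, ∇ f (z + s • e) ≠ 0 := by
    intro b hb hb0
    have hdb : d < b := lt_of_not_ge fun h => hreg b ⟨hb.1, h⟩ hb0
    obtain ⟨c, hc, hc0, hlt⟩ := exists_first_zero
      ((continuous_gradient hf.contDiff_one).comp
        (by fun_prop : Continuous fun s : ℝ => z + s • e)) hdb.le hb0
    have hdc : d < c := hc.1.lt_of_ne fun h => hreg d ⟨hd.1, le_rfl⟩ (h ▸ hc0)
    have hc_reg : ∀ s ∈ Ioo 0 c, ∇ f (z + s • e) ≠ 0 := fun s hs => by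
      rcases le_total s d with h | h
      exacts [hreg s ⟨hs.1, h⟩, hlt s ⟨h, hs.2⟩]
    have hfc : f (z + (0 : ℝ) • e) = f (z + c • e) := by
      rw [hval c ⟨hd.1.trans hdc, hc.2.trans_lt hb.2⟩ hc0, zero_smul, add_zero]
    have hderiv (s : ℝ) : HasDerivAt (fun s : ℝ => f (z + s • e)) ⟪∇ f (z + s • e), e⟫ s :=
      hasDerivAt_comp_of_differentiable (hf.1.differentiable two_ne_zero)
        (hasDerivAt_add_smul z e s)
    obtain ⟨s, hs, hs0⟩ := exists_hasDerivAt_eq_zero (hd.1.trans hdc)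
      (fun s _ => (hderiv s).continuousAt.continuousWithinAt) hfc fun s _ => hderiv s
    have := hf.isAligned_of_Ioo he ⟨hd.1, hdc⟩ hal hc_reg s (Ioo_subset_Icc_self hs)
    rw [IsAligned, hs0, zero_smul] at this
    exact hc_reg s hs this
  refine ⟨hfree ρ hρ, ?_⟩
  exact hf.isAligned_of_Ioo he hd hal hfree ρ (Ioo_subset_Icc_self hρ)

theorem isAligned_of_nearest (hf : IsMetricFunction f) (hx : ∇ f x ≠ 0) (hz : ∇ f z = 0)
    (hmin : ∀ q, ∇ f q = 0 → ‖x - z‖ ≤ ‖x - q‖) :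
    (∀ s ∈ Ioc 0 ‖x - z‖, ∇ f (z + s • NormedSpace.normalize (x - z)) ≠ 0) ∧
      IsAligned f x (NormedSpace.normalize (x - z)) := by
  have hd : 0 < ‖x - z‖ := norm_sub_pos_iff.2 fun h => hx (h ▸ hz)
  constructor
  · intro s hs h0
    refine (hmin _ h0).not_gt ?_
    nth_rw 1 [← sub_sub, ← NormedSpace.norm_smul_normalize (x - z)]
    rw [← sub_smul, norm_smul, NormedSpace.norm_normalize (norm_pos_iff.1 hd), mul_one,
      Real.norm_of_nonneg (sub_nonneg.2 hs.2)]
    exact sub_lt_self _ hs.1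
  · have hfree : ∀ a ∈ ball x ‖z - x‖, ∇ f a ≠ 0 := fun a ha ha0 => by
      rw [mem_ball_iff_norm', norm_sub_rev z x] at ha
      exact (hmin a ha0).not_gt ha
    have hν := NormedSpace.normalize_eq_self_of_norm_eq_one (norm_unitNormal hx)
    rw [norm_sub_rev] at hd
    rcases hf.eq_add_or_sub_smul_unitNormal_of_nearest hfree hz with h | h
    · rw [show x - z = ‖z - x‖ • -unitNormal f x by
          rw [smul_neg, ← sub_eq_of_eq_add' h, neg_sub],
        NormedSpace.normalize_smul_of_pos hd, NormedSpace.normalize_neg, hν]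
      exact (isAligned_unitNormal f x).neg
    · rw [show x - z = ‖z - x‖ • unitNormal f x from sub_eq_of_eq_add' (eq_sub_iff_add_eq.1 h).symm,
        NormedSpace.normalize_smul_of_pos hd, hν]
      exact isAligned_unitNormal f x

theorem exists_rays_tendsto (hf : IsMetricFunction f) (hw : ∇ f w = 0)
    (hm : m ∈ normalSpace (criticalSet f) w) (hm1 : ‖m‖ = 1) :
    ∃ (z e : ℝ → EuclideanSpace ℝ (Fin n)) (d : ℝ → ℝ), Tendsto z (𝓝[>] 0) (𝓝 w) ∧
      Tendsto e (𝓝[>] 0) (𝓝 m) ∧ ∀ᶠ s in 𝓝[>] 0, ∇ f (z s) = 0 ∧ ‖e s‖ = 1 ∧ d s ∈ Ioc 0 s ∧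
        (∀ t ∈ Ioc 0 (d s), ∇ f (z s + t • e s) ≠ 0) ∧ IsAligned f (z s + d s • e s) (e s) := by
  choose z hz0 hzmin using fun s : ℝ => exists_nearest_critical hf.contDiff_one hw (w + s • m)
  have hzle : ∀ᶠ s in 𝓝[>] 0, ‖w + s • m - z s‖ ≤ s := by
    filter_upwards [self_mem_nhdsWithin] with s (hs : 0 < s)
    simpa [norm_smul, hm1, abs_of_pos hs] using hzmin s w hw
  have hzo := isLittleO_sub_of_mem_normalSpace hm hm1 (.of_forall hz0) hzle
  have hquot : Tendsto (fun s : ℝ => s⁻¹ • (w + s • m - z s)) (𝓝[>] 0) (𝓝 m) := by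
    have hlim := (tendsto_const_nhds (x := m)).sub hzo.tendsto_inv_smul_nhds_zero
    rw [sub_zero] at hlim
    refine hlim.congr' ?_
    filter_upwards [self_mem_nhdsWithin] with s (hs : 0 < s)
    rw [add_sub_right_comm, smul_add, inv_smul_smul₀ hs.ne']
    module
  have hcont : ContinuousAt NormedSpace.normalize m :=
    (continuousAt_id.norm.inv₀ (by simp [hm1])).smul continuousAt_id
  have hnormalize := hcont.tendsto.comp hquot
  rw [NormedSpace.normalize_eq_self_of_norm_eq_one hm1] at hnormalize
  refine ⟨z, fun s => NormedSpace.normalize (w + s • m - z s), fun s => ‖w + s • m - z s‖,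
    ?_, hnormalize.congr' ?_, ?_⟩
  · have := hzo.trans_tendsto (tendsto_id.mono_left nhdsWithin_le_nhds)
    simpa using this.add_const w
  · filter_upwards [self_mem_nhdsWithin] with s (hs : 0 < s)
    exact NormedSpace.normalize_smul_of_pos (inv_pos.2 hs) _
  · filter_upwards [hzle, eventually_add_smul_notMem_of_mem_normalSpace hm hm1] with s hs hreg
    obtain ⟨hray, hal⟩ := hf.isAligned_of_nearest hreg (hz0 s) (hzmin s)
    have hne : w + s • m - z s ≠ 0 := fun h => hreg (sub_eq_zero.1 h ▸ hz0 s)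
    refine ⟨hz0 s, NormedSpace.norm_normalize hne, ⟨norm_pos_iff.2 hne, hs⟩, hray, ?_⟩
    rwa [NormedSpace.norm_smul_normalize, add_sub_cancel]

/-- The normal ray at `w` is the limit of the rays from nearest critical points `z s` through the
points `w + s m`, to which the nearest-point lemma and Rolle's theorem apply. -/
theorem gradient_ne_zero_and_isAligned_of_mem_normalSpace (hf : IsMetricFunction f)
    (hw : ∇ f w = 0) {r : ℝ} (hval : ∀ z ∈ ball w r, ∇ f z = 0 → f z = f w)
    (hm : m ∈ normalSpace (criticalSet f) w) (hm1 : ‖m‖ = 1) {ρ : ℝ} (hρ : ρ ∈ Ioo 0 r) :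
    ∇ f (w + ρ • m) ≠ 0 ∧ IsAligned f (w + ρ • m) m := by
  obtain ⟨z, e, d, hz, he, hrays⟩ := hf.exists_rays_tendsto hw hm hm1
  have hal : ∀ ρ ∈ Ioo 0 r, IsAligned f (w + ρ • m) m := by
    intro ρ hρ
    obtain ⟨R, hρR, hRr⟩ := exists_between hρ.2
    have hclose := hz.eventually (ball_mem_nhds w (sub_pos.2 hRr))
    have hsmall : ∀ᶠ s in 𝓝[>] (0 : ℝ), s < R :=
      eventually_nhdsWithin_of_eventually_nhds (eventually_lt_nhds (hρ.1.trans hρR))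
    refine (isClosed_setOf_isAligned hf.contDiff_one).mem_of_tendsto
      (f := fun s => (z s + ρ • e s, e s)) (x := (w + ρ • m, m)) (b := 𝓝[>] 0)
      ((hz.add (he.const_smul ρ)).prodMk_nhds he) ?_
    filter_upwards [hrays, hclose, hsmall] with s ⟨hz0, he1, hd, hreg, hal⟩ hzw hsR
    refine (hf.gradient_ne_zero_and_isAligned_of_ray he1 ⟨hd.1, hd.2.trans_lt hsR⟩ hreg hal
      (fun t ht ht0 => ?_) ⟨hρ.1, hρR⟩).2
    have hzw' := mem_ball_iff_norm.1 hzw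
    rw [hval _ (mem_ball_iff_norm.2 ?_) ht0,
      hval _ (ball_subset_ball (by linarith [ht.1, ht.2]) hzw) hz0]
    rw [add_sub_right_comm]
    refine (norm_add_le _ _).trans_lt ?_
    rw [norm_smul, he1, mul_one, Real.norm_of_nonneg ht.1.le]
    linarith [ht.2]
  obtain ⟨d, hd, hreg⟩ := mem_nhdsGT_iff_exists_Ioc_subset.1
    (eventually_add_smul_notMem_of_mem_normalSpace hm hm1)
  obtain ⟨d', hd', hdd⟩ := exists_between (lt_min hd (hρ.1.trans hρ.2))
  rw [lt_min_iff] at hdd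
  refine hf.gradient_ne_zero_and_isAligned_of_ray hm1 ⟨hd', hdd.2⟩
    (fun t ht => hreg ⟨ht.1, ht.2.trans hdd.1.le⟩) (hal d' ⟨hd', hdd.2⟩)
    (fun t ht => hval _ ?_) hρ
  rw [mem_ball_iff_norm, add_sub_cancel_left, norm_smul, hm1, mul_one, Real.norm_of_nonneg ht.1.le]
  exact ht.2

end IsMetricFunction

end NormalSegment

section GlobalLines

variable {n : ℕ} {f : EuclideanSpace ℝ (Fin n) → ℝ} {p w x z e : EuclideanSpace ℝ (Fin n)}
  {t : ℝ}

/-- The connected component of `p` in the critical set of `f`. -/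
def criticalComponent (f : EuclideanSpace ℝ (Fin n) → ℝ) (p : EuclideanSpace ℝ (Fin n)) :
    Set (EuclideanSpace ℝ (Fin n)) :=
  connectedComponentIn (criticalSet f) p

theorem mem_criticalComponent_self (hp : ∇ f p = 0) : p ∈ criticalComponent f p :=
  mem_connectedComponentIn hp

theorem isPreconnected_criticalComponent : IsPreconnected (criticalComponent f p) :=
  isPreconnected_connectedComponentIn

theorem gradient_eq_zero_of_mem_criticalComponent (h : z ∈ criticalComponent f p) : ∇ f z = 0 :=
  connectedComponentIn_subset (criticalSet f) p h

/-- A metric function all of whose critical components are relatively open regular surfaces of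
positive codimension, points being surfaces of dimension `0`: the hypotheses of the theorem, with
its two kinds of components merged. -/
structure IsRegularMetricFunction (f : EuclideanSpace ℝ (Fin n) → ℝ) : Prop where
  isMetricFunction : IsMetricFunction f
  exists_isRegularSurface : ∀ p, ∇ f p = 0 → ∃ r < n, IsRegularSurface 1 r (criticalComponent f p)
  eventually_mem_criticalComponent :
    ∀ p, ∇ f p = 0 → ∀ᶠ z in 𝓝 p, ∇ f z = 0 → z ∈ criticalComponent f p

theorem HasRegularCriticalSet.isRegularMetricFunction (hcrit : HasRegularCriticalSet f)
    (hf : IsMetricFunction f) (hn : 1 ≤ n) : IsRegularMetricFunction f where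
  isMetricFunction := hf
  exists_isRegularSurface p hp := by
    obtain ⟨hsingle | ⟨r, -, hr, hsurf⟩, -⟩ := hcrit p hp
    · refine ⟨0, hn, ?_⟩
      rw [criticalComponent, hsingle, ← planeThrough_bot,
        ← finrank_bot ℝ (EuclideanSpace ℝ (Fin n))]
      exact isRegularSurface_planeThrough p ⊥ 1
    · exact ⟨r, hr, hsurf⟩
  eventually_mem_criticalComponent p hp := by
    obtain ⟨-, O, hO, hOeq⟩ := hcrit p hp
    have hpO : p ∈ O ∩ criticalSet f := hOeq ▸ mem_criticalComponent_self hp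
    filter_upwards [hO.mem_nhds hpO.1] with z hz hz0
    exact hOeq.subset ⟨hz, hz0⟩

/-- `e` is normal to the foliation at `x`: a multiple of the gradient, and, where that says nothing,
orthogonal to the critical set. -/
structure IsNormal (f : EuclideanSpace ℝ (Fin n) → ℝ) (x e : EuclideanSpace ℝ (Fin n)) : Prop where
  isAligned : IsAligned f x e
  mem_normalSpace : ∇ f x = 0 → e ∈ normalSpace (criticalSet f) x

namespace IsNormal

theorem neg (h : IsNormal f x e) : IsNormal f x (-e) :=
  ⟨h.isAligned.neg, fun hx => neg_mem (h.mem_normalSpace hx)⟩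

theorem of_ne_zero (h : IsAligned f x e) (hx : ∇ f x ≠ 0) : IsNormal f x e :=
  ⟨h, fun hx' => absurd hx' hx⟩

theorem of_mem_normalSpace (h : e ∈ normalSpace (criticalSet f) x) (hx : ∇ f x = 0) :
    IsNormal f x e :=
  ⟨by simp [IsAligned, hx], fun _ => h⟩

end IsNormal

theorem isNormal_unitNormal (hx : ∇ f x ≠ 0) : IsNormal f x (unitNormal f x) :=
  .of_ne_zero (isAligned_unitNormal f x) hx

namespace IsRegularMetricFunction

theorem contDiff_one (hf : IsRegularMetricFunction f) : ContDiff ℝ 1 f :=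
  hf.isMetricFunction.contDiff_one

theorem differentiable (hf : IsRegularMetricFunction f) : Differentiable ℝ f :=
  hf.contDiff_one.differentiable one_ne_zero

theorem normalSpace_criticalComponent (hf : IsRegularMetricFunction f) (hw : ∇ f w = 0) :
    normalSpace (criticalComponent f w) w = normalSpace (criticalSet f) w := by
  refine normalSpace_congr (le_antisymm (nhdsWithin_mono _ (connectedComponentIn_subset _ _)) ?_)
  refine le_inf nhdsWithin_le_nhds (le_principal_iff.2 ?_)
  filter_upwards [self_mem_nhdsWithin, mem_nhdsWithin_of_mem_nhds
    (hf.eventually_mem_criticalComponent w hw)] with z hz hzmem using hzmem hz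

theorem sub_mem_normalSpace_of_nearest (hf : IsRegularMetricFunction f) (hw : ∇ f w = 0)
    (h : ∀ z ∈ criticalComponent f w, ‖x - w‖ ≤ ‖x - z‖) :
    x - w ∈ normalSpace (criticalSet f) w := by
  obtain ⟨r, -, hsurf⟩ := hf.exists_isRegularSurface w hw
  rw [← hf.normalSpace_criticalComponent hw]
  exact hsurf.sub_mem_normalSpace_of_nearest (mem_criticalComponent_self hw) h

theorem finrank_normalSpace_pos (hf : IsRegularMetricFunction f) (hw : ∇ f w = 0) :
    0 < Module.finrank ℝ (normalSpace (criticalSet f) w) := by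
  obtain ⟨r, hr, hsurf⟩ := hf.exists_isRegularSurface w hw
  have hrank := hsurf.finrank_normalSpace (mem_criticalComponent_self hw)
  rw [hf.normalSpace_criticalComponent hw] at hrank
  omega

theorem exists_unit_mem_normalSpace (hf : IsRegularMetricFunction f) (hw : ∇ f w = 0) :
    ∃ m ∈ normalSpace (criticalSet f) w, ‖m‖ = 1 := by
  have : Nontrivial (normalSpace (criticalSet f) w) :=
    Module.nontrivial_of_finrank_pos (hf.finrank_normalSpace_pos hw)
  obtain ⟨m, hm⟩ := exists_norm_eq (normalSpace (criticalSet f) w) zero_le_one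
  exact ⟨m, m.2, hm⟩

theorem eq_of_mem_criticalComponent (hf : IsRegularMetricFunction f) (hw : ∇ f w = 0)
    (hz : z ∈ criticalComponent f w) : f z = f w := by
  obtain ⟨r, -, hsurf⟩ := hf.exists_isRegularSurface w hw
  exact hsurf.eq_of_gradient_eq_zero isPreconnected_criticalComponent hf.differentiable
    (fun _ => gradient_eq_zero_of_mem_criticalComponent) hz (mem_criticalComponent_self hw)

theorem exists_ball_critical_value_eq (hf : IsRegularMetricFunction f) (hw : ∇ f w = 0) :
    ∃ r > 0, ∀ z ∈ ball w r, ∇ f z = 0 → f z = f w := by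
  obtain ⟨r, hr, hball⟩ :=
    Metric.eventually_nhds_iff_ball.1 (hf.eventually_mem_criticalComponent w hw)
  exact ⟨r, hr, fun z hz hz0 => hf.eq_of_mem_criticalComponent hw (hball z hz hz0)⟩

theorem mem_normalSpace_of_hit (hf : IsRegularMetricFunction f) (he : ‖e‖ = 1)
    (hx : IsAligned f x e) (ht : 0 < t) (hreg : ∀ s ∈ Ico 0 t, ∇ f (x + s • e) ≠ 0)
    (hw : ∇ f (x + t • e) = 0) : e ∈ normalSpace (criticalSet f) (x + t • e) := by
  have hmid := hf.isMetricFunction.isAligned_add_smul he hx hreg (t / 2) ⟨by linarith, by linarith⟩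
  have hfree {z : EuclideanSpace ℝ (Fin n)} (hz : z ∈ ball (x + (t / 2) • e) (t / 2)) :
      ∇ f z ≠ 0 :=
    hf.isMetricFunction.gradient_ne_zero_of_mem_ball he hmid (fun s hs => by
      rw [add_assoc, ← add_smul]
      exact hreg _ ⟨by linarith [hs.1], by linarith [hs.2]⟩) hz
  have hsub : x + (t / 2) • e - (x + t • e) = -(t / 2) • e := by module
  have hmem := hf.sub_mem_normalSpace_of_nearest (x := x + (t / 2) • e) hw fun z hz => by
    rw [hsub, norm_smul, he, mul_one, norm_neg, Real.norm_of_nonneg (by linarith), ← not_lt]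
    exact fun h => hfree (mem_ball_iff_norm'.2 h) (gradient_eq_zero_of_mem_criticalComponent hz)
  rw [hsub] at hmem
  exact (Submodule.smul_mem_iff _ (by linarith)).1 hmem

/-- Were the line to meet the critical set strictly between `x` and `x + t e`, then its remaining
part would be a normal segment and `x + t e` would not be critical. -/
theorem isNormal_add_smul_of_critical (hf : IsRegularMetricFunction f) (he : ‖e‖ = 1)
    (hx : IsNormal f x e) (ht : 0 ≤ t) (hw : ∇ f (x + t • e) = 0) {r : ℝ} (htr : 2 * t < r)
    (hval : ∀ z ∈ ball (x + t • e) r, ∇ f z = 0 → f z = f (x + t • e)) :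
    IsNormal f (x + t • e) e := by
  have hne : ∀ s ∈ Ico 0 t, e ∈ normalSpace (criticalSet f) (x + s • e) →
      ∇ f (x + s • e) ≠ 0 := by
    intro s hs hes hs0
    have hdist : x + s • e - (x + t • e) = (s - t) • e := by module
    have hball {z : EuclideanSpace ℝ (Fin n)} (hz : z ∈ ball (x + s • e) (r - t)) :
        z ∈ ball (x + t • e) r := by
      refine ball_subset_ball' ?_ hz
      rw [dist_eq_norm, hdist, norm_smul, he, mul_one, Real.norm_of_nonpos (by linarith [hs.2])]
      linarith [hs.1]
    have hr : 0 < r - t := by linarith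
    have := (hf.isMetricFunction.gradient_ne_zero_and_isAligned_of_mem_normalSpace hs0
      (fun z hz hz0 => (hval z (hball hz) hz0).trans
        (hval _ (hball (mem_ball_self hr)) hs0).symm) hes he (ρ := t - s)
      ⟨by linarith [hs.2], by linarith [hs.1]⟩).1
    rw [add_assoc, ← add_smul, add_sub_cancel] at this
    exact this hw
  obtain ⟨c, hc, hc0, hlt⟩ := exists_first_zero
    ((continuous_gradient hf.contDiff_one).comp
      (by fun_prop : Continuous fun s : ℝ => x + s • e)) ht hw
  have hec : e ∈ normalSpace (criticalSet f) (x + c • e) := by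
    rcases hc.1.eq_or_lt with rfl | hc_pos
    · simpa using hx.mem_normalSpace (by simpa using hc0)
    · exact hf.mem_normalSpace_of_hit he hx.isAligned hc_pos hlt hc0
  obtain rfl : c = t := by
    by_contra hct
    exact hne c ⟨hc.1, hc.2.lt_of_ne hct⟩ hec hc0
  exact .of_mem_normalSpace hec hw

theorem exists_forall_Ioo_isNormal (hf : IsRegularMetricFunction f) (he : ‖e‖ = 1)
    (hx : IsNormal f x e) :
    ∃ r > 0, ∀ s ∈ Ioo (0 : ℝ) r, ∇ f (x + s • e) ≠ 0 ∧ IsNormal f (x + s • e) e := by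
  suffices ∃ r > 0, ∀ s ∈ Ioo (0 : ℝ) r, ∇ f (x + s • e) ≠ 0 ∧ IsAligned f (x + s • e) e by
    obtain ⟨r, hr, h⟩ := this
    exact ⟨r, hr, fun s hs => ⟨(h s hs).1, .of_ne_zero (h s hs).2 (h s hs).1⟩⟩
  by_cases hx0 : ∇ f x = 0
  · obtain ⟨r, hr, hval⟩ := hf.exists_ball_critical_value_eq hx0
    exact ⟨r, hr, fun s => hf.isMetricFunction.gradient_ne_zero_and_isAligned_of_mem_normalSpace
      hx0 hval (hx.mem_normalSpace hx0) he⟩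
  · obtain ⟨r, hr, hball⟩ :=
      Metric.eventually_nhds_iff_ball.1 (eventually_gradient_ne_zero hf.contDiff_one hx0)
    have hreg : ∀ s ∈ Ico (0 : ℝ) r, ∇ f (x + s • e) ≠ 0 := fun s hs => hball _ <| by
      rw [mem_ball_iff_norm, add_sub_cancel_left, norm_smul, he, mul_one,
        Real.norm_of_nonneg hs.1]
      exact hs.2
    exact ⟨r, hr, fun s hs => ⟨hreg s (Ioo_subset_Ico_self hs),
      hf.isMetricFunction.isAligned_add_smul he hx.isAligned hreg s (Ioo_subset_Icc_self hs)⟩⟩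

theorem isOpen_setOf_isNormal (hf : IsRegularMetricFunction f) (he : ‖e‖ = 1) :
    IsOpen {t : ℝ | IsNormal f (x + t • e) e} := by
  refine Metric.isOpen_iff.2 fun t ht => ?_
  obtain ⟨r, hr, hright⟩ := hf.exists_forall_Ioo_isNormal he ht
  obtain ⟨l, hl, hleft⟩ := hf.exists_forall_Ioo_isNormal (by rwa [norm_neg]) ht.neg
  refine ⟨min r l, lt_min hr hl, fun s hs => ?_⟩
  rw [Real.ball_eq_Ioo, mem_Ioo] at hs
  rcases lt_trichotomy s t with h | rfl | h
  · have := (hleft (t - s) ⟨by linarith, by linarith [min_le_right r l]⟩).2.neg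
    rwa [neg_neg, show x + t • e + (t - s) • -e = x + s • e by module] at this
  · exact ht
  · have := (hright (s - t) ⟨by linarith, by linarith [min_le_left r l]⟩).2
    rwa [add_assoc, ← add_smul, add_sub_cancel] at this

theorem isClosed_setOf_isNormal (hf : IsRegularMetricFunction f) (he : ‖e‖ = 1) :
    IsClosed {t : ℝ | IsNormal f (x + t • e) e} := by
  refine isClosed_of_closure_subset fun t ht => ?_
  by_cases hw : ∇ f (x + t • e) = 0
  · obtain ⟨r, hr, hval⟩ := hf.exists_ball_critical_value_eq hw
    obtain ⟨s, hs, hst⟩ := Metric.mem_closure_iff.1 ht (r / 2) (half_pos hr)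
    rw [Real.dist_eq, abs_sub_lt_iff] at hst
    rcases le_total s t with h | h
    · have hline : x + s • e + (t - s) • e = x + t • e := by module
      have := hf.isNormal_add_smul_of_critical he hs (sub_nonneg.2 h) (r := r)
      rw [hline] at this
      exact this hw (by linarith) hval
    · have hline : x + s • e + (s - t) • -e = x + t • e := by module
      have := hf.isNormal_add_smul_of_critical (by rwa [norm_neg]) hs.neg (sub_nonneg.2 h) (r := r)
      rw [hline] at this
      simpa using (this hw (by linarith) hval).neg
  · have hclosed : IsClosed {s : ℝ | IsAligned f (x + s • e) e} :=
      (isClosed_setOf_isAligned hf.contDiff_one).preimage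
        (show Continuous fun s : ℝ => (x + s • e, e) by fun_prop)
    exact .of_ne_zero (closure_minimal (fun s hs => hs.isAligned) hclosed ht) hw

theorem isNormal_add_smul (hf : IsRegularMetricFunction f) (he : ‖e‖ = 1) (hx : IsNormal f x e)
    (t : ℝ) : IsNormal f (x + t • e) e := by
  have hclopen : IsClopen {t : ℝ | IsNormal f (x + t • e) e} :=
    ⟨hf.isClosed_setOf_isNormal he, hf.isOpen_setOf_isNormal he⟩
  have := hclopen.eq_univ ⟨0, by simpa using hx⟩
  exact this.ge (mem_univ t)

theorem frequently_gradient_ne_zero (hf : IsRegularMetricFunction f)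
    (x : EuclideanSpace ℝ (Fin n)) : ∃ᶠ y in 𝓝 x, ∇ f y ≠ 0 := by
  by_cases hx : ∇ f x = 0
  · obtain ⟨m, hm, hm1⟩ := hf.exists_unit_mem_normalSpace hx
    obtain ⟨r, hr, hreg⟩ := hf.exists_forall_Ioo_isNormal hm1 (.of_mem_normalSpace hm hx)
    have hline : Tendsto (fun s : ℝ => x + s • m) (𝓝[>] 0) (𝓝 x) :=
      ((continuous_const.add (continuous_id.smul continuous_const)).tendsto' (0 : ℝ) x
        (by simp)).mono_left nhdsWithin_le_nhds
    refine hline.frequently (Eventually.frequently ?_)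
    filter_upwards [Ioo_mem_nhdsGT hr] with s hs using (hreg s hs).1
  · exact (eventually_gradient_ne_zero hf.contDiff_one hx).frequently

end IsRegularMetricFunction

end GlobalLines

section ParallelSurfaces

variable {n : ℕ} {f : EuclideanSpace ℝ (Fin n) → ℝ} {x y : EuclideanSpace ℝ (Fin n)} {t : ℝ}

/-- The point at signed distance `t` from `y` along the normal to the level surface of `f` through
`y`; it carries that surface to the parallel one at distance `t`. -/
noncomputable def normalMap (f : EuclideanSpace ℝ (Fin n) → ℝ) (t : ℝ)
    (y : EuclideanSpace ℝ (Fin n)) : EuclideanSpace ℝ (Fin n) :=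
  y + t • unitNormal f y

theorem hasFDerivAt_normalMap (hf : ContDiff ℝ 2 f) (hx : ∇ f x ≠ 0) (t : ℝ) :
    HasFDerivAt (normalMap f t)
      (ContinuousLinearMap.id ℝ _ + t • fderiv ℝ (unitNormal f) x) x :=
  (hasFDerivAt_id x).add ((hasFDerivAt_unitNormal hf hx).const_smul t)

namespace IsMetricFunction

theorem gradient_ne_zero_of_mem_levelSurface (hf : IsMetricFunction f) (hx : ∇ f x ≠ 0)
    (hy : y ∈ levelSurface f x) : ∇ f y ≠ 0 := by
  rw [← norm_ne_zero_iff, hf.2 x y hy]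
  exact norm_ne_zero_iff.2 hx

theorem sub_eq_smul_unitNormal_of_nearest (hf : IsMetricFunction f) (hy : ∇ f y ≠ 0)
    (h : ∀ z ∈ levelSurface f y, ‖x - y‖ ≤ ‖x - z‖) :
    x - y = ⟪unitNormal f y, x - y⟫ • unitNormal f y := by
  have hperp : ∀ v, ⟪unitNormal f y, v⟫ = 0 → ⟪x - y, v⟫ = 0 := by
    intro v hv
    obtain ⟨c, rfl, hc, hmem⟩ :=
      exists_curve_in_levelSurface hf.contDiff_one hy ((inner_gradient_eq_zero_iff hy).2 hv)
    have hmin : IsLocalMin (fun s => ‖x - c s‖ ^ 2) 0 := by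
      filter_upwards [hmem] with s hs
      exact pow_le_pow_left₀ (norm_nonneg _) (h _ hs) 2
    simpa using hmin.hasDerivAt_eq_zero (hc.const_sub x).norm_sq
  have hv : ⟪unitNormal f y, x - y - ⟪unitNormal f y, x - y⟫ • unitNormal f y⟫ = 0 := by
    rw [inner_sub_right, inner_smul_right, inner_unitNormal_self hy, mul_one, sub_self]
  rw [← sub_eq_zero, ← inner_self_eq_zero (𝕜 := ℝ), inner_sub_left, hperp _ hv, inner_smul_left,
    hv, mul_zero, sub_zero]

end IsMetricFunction

namespace IsRegularMetricFunction

theorem isAligned_normalMap (hf : IsRegularMetricFunction f) (hy : ∇ f y ≠ 0) (t : ℝ) :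
    IsAligned f (normalMap f t y) (unitNormal f y) :=
  (hf.isNormal_add_smul (norm_unitNormal hy) (isNormal_unitNormal hy) t).isAligned

theorem apply_normalMap_eq (hf : IsRegularMetricFunction f) (hx : ∇ f x ≠ 0)
    (hy : y ∈ levelSurface f x) (t : ℝ) : f (normalMap f t y) = f (normalMap f t x) := by
  have hreg (a) (ha : a ∈ levelSurface f x) : ∇ f a ≠ 0 :=
    hf.isMetricFunction.gradient_ne_zero_of_mem_levelSurface hx ha
  refine eqOn_levelSurface_of_fderiv_eq_zero_on_ker (k := fun a => f (normalMap f t a))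
    hf.contDiff_one hreg (fun a ha => ?_) hy
  filter_upwards [eventually_gradient_ne_zero hf.contDiff_one (hreg a ha)] with b hb
  have hd := (hf.differentiable (normalMap f t b)).hasGradientAt.hasFDerivAt.comp b
    (hasFDerivAt_normalMap hf.isMetricFunction.1 hb t)
  refine ⟨hd.differentiableAt, fun v hv => ?_⟩
  have hv' := (inner_gradient_eq_zero_iff hb).1 hv
  rw [show fderiv ℝ (fun a => f (normalMap f t a)) b = _ from hd.fderiv]
  change ⟪∇ f (normalMap f t b), v + t • fderiv ℝ (unitNormal f) b v⟫ = 0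
  rw [hf.isAligned_normalMap hb t, real_inner_smul_left, inner_add_right, inner_smul_right,
    inner_unitNormal_fderiv hf.isMetricFunction.1 hb, hv', mul_zero, add_zero, mul_zero]

theorem inner_gradient_normalMap_eq (hf : IsRegularMetricFunction f) (hx : ∇ f x ≠ 0)
    (hy : y ∈ levelSurface f x) (t : ℝ) :
    ⟪∇ f (normalMap f t y), unitNormal f y⟫ = ⟪∇ f (normalMap f t x), unitNormal f x⟫ := by
  have hderiv (z : EuclideanSpace ℝ (Fin n)) : HasDerivAt (fun s => f (normalMap f s z))
      ⟪∇ f (normalMap f t z), unitNormal f z⟫ t :=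
    hasDerivAt_comp_of_differentiable hf.differentiable (hasDerivAt_add_smul z _ t)
  refine (hderiv y).unique ?_
  rw [funext (hf.apply_normalMap_eq hx hy)]
  exact hderiv x

theorem gradient_normalMap_eq_zero (hf : IsRegularMetricFunction f) (hx : ∇ f x ≠ 0)
    (hy : y ∈ levelSurface f x) (hw : ∇ f (normalMap f t x) = 0) :
    ∇ f (normalMap f t y) = 0 := by
  rw [hf.isAligned_normalMap (hf.isMetricFunction.gradient_ne_zero_of_mem_levelSurface hx hy) t,
    hf.inner_gradient_normalMap_eq hx hy t, hw, inner_zero_left, zero_smul]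

end IsRegularMetricFunction

end ParallelSurfaces

section TangentBounds

variable {E : Type*} [NormedAddCommGroup E] [InnerProductSpace ℝ E] {q w e : ℝ → E} {p a u : E}
  {r : ℝ}

theorem mul_abs_inner_le_of_tangent_bounds (hq : HasDerivAt q a 0) (hq0 : q 0 = p)
    (hw : HasDerivAt w 0 0) (hw0 : w 0 = p) (he : HasDerivAt e u 0) (hr : 0 ≤ r)
    (hqw : ∀ᶠ s in 𝓝 0, r * |⟪q s - w s, e s⟫| ≤ ‖q s - w s‖ ^ 2)
    (hqp : ∀ᶠ s in 𝓝 0, r * |⟪q s - p, e 0⟫| ≤ ‖q s - p‖ ^ 2)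
    (hwp : ∀ᶠ s in 𝓝 0, r * |⟪w s - p, e 0⟫| ≤ ‖w s - p‖ ^ 2) :
    r * |⟪a, u⟫| ≤ 2 * ‖a‖ ^ 2 := by
  have hq' := hq.tendsto_slope_zero
  have hw' := hw.tendsto_slope_zero
  have he' := he.tendsto_slope_zero
  have hqw' := (hq.sub hw).tendsto_slope_zero
  simp only [zero_add, Pi.sub_apply, hq0, hw0, sub_self, sub_zero] at hq' hw' he' hqw'
  have hrhs := ((hqw'.norm.pow 2).add (hq'.norm.pow 2)).add (hw'.norm.pow 2)
  rw [norm_zero, zero_pow two_ne_zero, add_zero, ← two_mul] at hrhs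
  refine le_of_tendsto_of_tendsto ((hqw'.inner he').abs.const_mul r) hrhs ?_
  filter_upwards [nhdsWithin_le_nhds hqw, nhdsWithin_le_nhds hqp, nhdsWithin_le_nhds hwp]
    with s h1 h2 h3
  have hsplit : ⟪q s - w s, e s - e 0⟫ = ⟪q s - w s, e s⟫ - ⟪q s - p, e 0⟫ + ⟪w s - p, e 0⟫ := by
    simp only [inner_sub_right, inner_sub_left]
    ring
  calc r * |⟪s⁻¹ • (q s - w s), s⁻¹ • (e s - e 0)⟫|
      = (s⁻¹) ^ 2 * (r * |⟪q s - w s, e s⟫ - ⟪q s - p, e 0⟫ + ⟪w s - p, e 0⟫|) := by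
        rw [real_inner_smul_left, inner_smul_right, hsplit, ← mul_assoc, ← sq, abs_mul, abs_sq]
        ring
    _ ≤ (s⁻¹) ^ 2 * (r * (|⟪q s - w s, e s⟫| + |⟪q s - p, e 0⟫| + |⟪w s - p, e 0⟫|)) := by
        gcongr
        exact (abs_add_le _ _).trans (by gcongr; exact abs_sub _ _)
    _ ≤ (s⁻¹) ^ 2 * (‖q s - w s‖ ^ 2 + ‖q s - p‖ ^ 2 + ‖w s - p‖ ^ 2) := by
        gcongr
        linarith
    _ = _ := by
        simp only [norm_smul, mul_pow, Real.norm_eq_abs, sq_abs]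
        ring

/-- The point runs along the curve `c` at a small speed `A` relative to `w` and `e`: the left side
of the bound above is of first order in `A`, its right side of second order. -/
theorem inner_eq_zero_of_tangent_bounds {c : ℝ → E} {S : Set E} (hc : HasDerivAt c a 0)
    (hc0 : c 0 = p) (hcS : ∀ᶠ s in 𝓝 0, c s ∈ S) (hw : HasDerivAt w 0 0) (hw0 : w 0 = p)
    (hwS : ∀ᶠ s in 𝓝 0, w s ∈ S) (he : HasDerivAt e u 0) (hr : 0 < r)
    (hbound : ∀ᶠ s in 𝓝 0, ∀ q ∈ S, r * |⟪q - w s, e s⟫| ≤ ‖q - w s‖ ^ 2) : ⟪a, u⟫ = 0 := by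
  have hbound0 := hbound.self_of_nhds
  rw [hw0] at hbound0
  have hscale : ∀ A > 0, r * |⟪a, u⟫| ≤ A * (2 * ‖a‖ ^ 2) := by
    intro A hA
    have hcA : HasDerivAt (fun s => c (A * s)) (A • a) 0 := by
      have hmul := (hasDerivAt_id (0 : ℝ)).const_mul A
      rw [mul_one] at hmul
      exact HasDerivAt.scomp (0 : ℝ) (by simpa using hc) hmul
    have hcAS : ∀ᶠ s in 𝓝 0, c (A * s) ∈ S :=
      ((continuous_const_mul A).tendsto' 0 0 (mul_zero A)).eventually hcS
    have := mul_abs_inner_le_of_tangent_bounds hcA (by simpa using hc0) hw hw0 he hr.le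
      (hbound.mp (hcAS.mono fun s hs h => h _ hs)) (hcAS.mono fun s => hbound0 _)
      (hwS.mono fun s => hbound0 _)
    rw [real_inner_smul_left, abs_mul, abs_of_pos hA, norm_smul, Real.norm_of_nonneg hA.le] at this
    nlinarith
  have hlim : Tendsto (fun A => A * (2 * ‖a‖ ^ 2)) (𝓝[>] 0) (𝓝 0) :=
    ((continuous_mul_const _).tendsto' 0 0 (zero_mul _)).mono_left nhdsWithin_le_nhds
  have hle : r * |⟪a, u⟫| ≤ 0 := ge_of_tendsto hlim (by
    filter_upwards [self_mem_nhdsWithin] with A hA using hscale A hA)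
  exact abs_nonpos_iff.1 (nonpos_of_mul_nonpos_right hle hr)

end TangentBounds

section FocalPoints

variable {n : ℕ} {f : EuclideanSpace ℝ (Fin n) → ℝ} {q w y e v : EuclideanSpace ℝ (Fin n)} {t : ℝ}

namespace IsRegularMetricFunction

/-- Neither of the two balls of radius `r / 2` tangent to the critical set at `w`, with centres
`w ± (r / 2) e`, contains a critical point. -/
theorem mul_abs_inner_le_of_gradient_eq_zero (hf : IsRegularMetricFunction f) (hw : ∇ f w = 0)
    {r : ℝ} (hr : 0 < r) (hval : ∀ z ∈ ball w r, ∇ f z = 0 → f z = f w) (he : ‖e‖ = 1)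
    (hew : e ∈ normalSpace (criticalSet f) w) (hq : ∇ f q = 0) :
    r * |⟪q - w, e⟫| ≤ ‖q - w‖ ^ 2 := by
  suffices hside : ∀ m ∈ normalSpace (criticalSet f) w, ‖m‖ = 1 →
      r * ⟪q - w, m⟫ ≤ ‖q - w‖ ^ 2 by
    have hneg := hside (-e) (neg_mem hew) (by rwa [norm_neg])
    rw [inner_neg_right] at hneg
    rcases abs_choice ⟪q - w, e⟫ with h | h <;> rw [h]
    exacts [hside e hew he, hneg]
  intro m hm hm1
  have hray : ∀ s ∈ Ioo 0 r, ∇ f (w + s • m) ≠ 0 ∧ IsAligned f (w + s • m) m := fun s hs =>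
    hf.isMetricFunction.gradient_ne_zero_and_isAligned_of_mem_normalSpace hw hval hm hm1 hs
  have hout : q ∉ ball (w + (r / 2) • m) (r / 2) := fun hmem =>
    hf.isMetricFunction.gradient_ne_zero_of_mem_ball hm1
      (hray (r / 2) ⟨by linarith, by linarith⟩).2 (fun s hs => by
        rw [add_assoc, ← add_smul]
        exact (hray _ ⟨by linarith [hs.1], by linarith [hs.2]⟩).1) hmem hq
  rw [mem_ball_iff_norm, not_lt, ← sub_sub, ← sq_le_sq₀ (by linarith) (norm_nonneg _),
    norm_sub_sq_real, norm_smul, hm1, inner_smul_right, mul_one, Real.norm_eq_abs, sq_abs] at hout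
  linarith

theorem exists_eventually_mul_abs_inner_le (hf : IsRegularMetricFunction f) (hy : ∇ f y ≠ 0)
    (hw : ∇ f (normalMap f t y) = 0) :
    ∃ r > 0, ∀ᶠ z in 𝓝 y, z ∈ levelSurface f y → ∀ q, ∇ f q = 0 →
      r * |⟪q - normalMap f t z, unitNormal f z⟫| ≤ ‖q - normalMap f t z‖ ^ 2 := by
  obtain ⟨r, hr, hval⟩ := hf.exists_ball_critical_value_eq hw
  have hnear : ∀ᶠ z in 𝓝 y, normalMap f t z ∈ ball (normalMap f t y) (r / 2) :=
    (hasFDerivAt_normalMap hf.isMetricFunction.1 hy t).continuousAt.eventually_mem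
      (ball_mem_nhds _ (half_pos hr))
  refine ⟨r / 2, half_pos hr, ?_⟩
  filter_upwards [hnear] with z hz hzy q hq
  have hz0 := hf.isMetricFunction.gradient_ne_zero_of_mem_levelSurface hy hzy
  have hwz := hf.gradient_normalMap_eq_zero hy hzy hw
  refine hf.mul_abs_inner_le_of_gradient_eq_zero hwz (half_pos hr) (fun a ha ha0 => ?_)
    (norm_unitNormal hz0) ((hf.isNormal_add_smul (norm_unitNormal hz0) (isNormal_unitNormal hz0)
      t).mem_normalSpace hwz) hq
  have hball : ball (normalMap f t z) (r / 2) ⊆ ball (normalMap f t y) r :=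
    ball_subset_ball' (by linarith [mem_ball.1 hz])
  rw [hval a (hball ha) ha0, hval _ (hball (mem_ball_self (half_pos hr))) hwz]

theorem eq_zero_of_focal_of_gradient_eq_zero (hf : IsRegularMetricFunction f) (hy : ∇ f y ≠ 0)
    (hw : ∇ f (normalMap f t y) = 0)
    (hv : v ∈ (normalSpace (criticalSet f) (normalMap f t y))ᗮ)
    (hfocal : v + t • fderiv ℝ (unitNormal f) y v = 0) : v = 0 := by
  have hνw := (hf.isNormal_add_smul (norm_unitNormal hy) (isNormal_unitNormal hy)
    t).mem_normalSpace hw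
  obtain ⟨r, hr, hbound⟩ := hf.exists_eventually_mul_abs_inner_le hy hw
  obtain ⟨γ, hγ0, hγ, hγy⟩ := exists_curve_in_levelSurface hf.contDiff_one hy
    ((inner_gradient_eq_zero_iff hy).2 (hv _ hνw))
  obtain ⟨k, -, hsurf⟩ := hf.exists_isRegularSurface _ hw
  rw [← hf.normalSpace_criticalComponent hw] at hv
  obtain ⟨c, hc0, hc, hcC⟩ := hsurf.exists_curve (mem_criticalComponent_self hw) hv
  have hν : HasDerivAt (fun s => unitNormal f (γ s)) (fderiv ℝ (unitNormal f) y v) 0 := by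
    rw [← hγ0] at hy ⊢
    exact (hasFDerivAt_unitNormal hf.isMetricFunction.1 hy).comp_hasDerivAt 0 hγ
  have hp : HasDerivAt (fun s => normalMap f t (γ s)) 0 0 := by
    rw [← hfocal]
    exact hγ.add (hν.const_smul t)
  have hinner : ⟪v, fderiv ℝ (unitNormal f) y v⟫ = 0 :=
    inner_eq_zero_of_tangent_bounds (S := criticalSet f) hc hc0
      (hcC.mono fun s hs => gradient_eq_zero_of_mem_criticalComponent hs) hp (by rw [hγ0])
      (hγy.mono fun s hs => hf.gradient_normalMap_eq_zero hy hs hw) hν hr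
      (hγy.mp (hγ.continuousAt.eventually (by rwa [hγ0])))
  rw [← inner_self_eq_zero (𝕜 := ℝ)]
  nth_rw 2 [eq_neg_of_add_eq_zero_left hfocal]
  rw [inner_neg_right, inner_smul_right, hinner, mul_zero, neg_zero]

theorem exists_eventually_normalMap_normalMap_eq (hf : IsRegularMetricFunction f) (hy : ∇ f y ≠ 0)
    (hw : ∇ f (normalMap f t y) ≠ 0) :
    ∃ τ, ∀ᶠ z in 𝓝 y, normalMap f τ (normalMap f t z) = z := by
  have hp := (hasFDerivAt_normalMap hf.isMetricFunction.1 hy t).continuousAt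
  have hsign : ∀ᶠ z in 𝓝 y, ∇ f z ≠ 0 ∧ (unitNormal f (normalMap f t z) = unitNormal f z ∨
      unitNormal f (normalMap f t z) = -unitNormal f z) := by
    filter_upwards [eventually_gradient_ne_zero hf.contDiff_one hy,
      hp.eventually (eventually_gradient_ne_zero hf.contDiff_one hw)] with z hz hwz
    exact ⟨hz, (hf.isAligned_normalMap hz t).unitNormal_eq_or (norm_unitNormal hz) hwz⟩
  have hcont : ContinuousAt (fun z => ⟪unitNormal f (normalMap f t z), unitNormal f z⟫) y :=
    ((hasFDerivAt_unitNormal hf.isMetricFunction.1 hw).continuousAt.comp hp).inner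
      (hasFDerivAt_unitNormal hf.isMetricFunction.1 hy).continuousAt
  rcases hsign.self_of_nhds.2 with h | h
  · rw [ContinuousAt, h, inner_unitNormal_self hy] at hcont
    refine ⟨-t, ?_⟩
    filter_upwards [hsign, hcont.eventually_const_lt one_pos] with z ⟨hz, hz'⟩ hpos
    have hν : unitNormal f (normalMap f t z) = unitNormal f z := hz'.resolve_right fun h' => by
      rw [h', inner_neg_left, inner_unitNormal_self hz] at hpos
      linarith
    rw [normalMap, hν, normalMap, neg_smul, add_neg_cancel_right]
  · rw [ContinuousAt, h, inner_neg_left, inner_unitNormal_self hy] at hcont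
    refine ⟨t, ?_⟩
    filter_upwards [hsign, hcont.eventually_lt_const neg_one_lt_zero] with z ⟨hz, hz'⟩ hneg
    have hν : unitNormal f (normalMap f t z) = -unitNormal f z := hz'.resolve_left fun h' => by
      rw [h', inner_unitNormal_self hz] at hneg
      linarith
    rw [normalMap, hν, normalMap, smul_neg, add_neg_cancel_right]

theorem eq_zero_of_focal_of_gradient_ne_zero (hf : IsRegularMetricFunction f) (hy : ∇ f y ≠ 0)
    (hw : ∇ f (normalMap f t y) ≠ 0) (hfocal : v + t • fderiv ℝ (unitNormal f) y v = 0) :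
    v = 0 := by
  obtain ⟨τ, hτ⟩ := hf.exists_eventually_normalMap_normalMap_eq hy hw
  have hcomp := (hasFDerivAt_normalMap hf.isMetricFunction.1 hw τ).comp y
    (hasFDerivAt_normalMap hf.isMetricFunction.1 hy t)
  have hid := (hcomp.congr_of_eventuallyEq (EventuallyEq.symm hτ)).unique (hasFDerivAt_id y)
  have hker : (ContinuousLinearMap.id ℝ (EuclideanSpace ℝ (Fin n)) +
      t • fderiv ℝ (unitNormal f) y) v = 0 := hfocal
  change ContinuousLinearMap.id ℝ (EuclideanSpace ℝ (Fin n)) v = 0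
  rw [← hid, ContinuousLinearMap.comp_apply, hker, map_zero]

theorem eq_zero_of_focal (hf : IsRegularMetricFunction f) (hy : ∇ f y ≠ 0)
    (hv : ∇ f (normalMap f t y) = 0 → v ∈ (normalSpace (criticalSet f) (normalMap f t y))ᗮ)
    (hfocal : v + t • fderiv ℝ (unitNormal f) y v = 0) : v = 0 := by
  by_cases hw : ∇ f (normalMap f t y) = 0
  · exact hf.eq_zero_of_focal_of_gradient_eq_zero hy hw (hv hw) hfocal
  · exact hf.eq_zero_of_focal_of_gradient_ne_zero hy hw hfocal

end IsRegularMetricFunction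

end FocalPoints

section Hyperplanes

theorem eq_zero_of_isSymmetric_of_hasEigenvalue_imp {E : Type*} [NormedAddCommGroup E]
    [InnerProductSpace ℝ E] [FiniteDimensional ℝ E] {T : E →ₗ[ℝ] E} (hT : T.IsSymmetric)
    (h : ∀ μ, Module.End.HasEigenvalue T μ → μ = 0) : T = 0 :=
  (hT.eigenvectorBasis rfl).toBasis.ext fun i => by
    rw [OrthonormalBasis.coe_toBasis, hT.apply_eigenvectorBasis rfl i,
      h _ (hT.hasEigenvalue_eigenvalues rfl i)]
    simp

variable {n : ℕ} {f : EuclideanSpace ℝ (Fin n) → ℝ} {y : EuclideanSpace ℝ (Fin n)}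

namespace IsRegularMetricFunction

theorem mem_orthogonal_normalSpace_of_finrank_eq_one (hf : IsRegularMetricFunction f)
    {v : EuclideanSpace ℝ (Fin n)} {t : ℝ} (hy : ∇ f y ≠ 0) (hv : ⟪unitNormal f y, v⟫ = 0)
    (hw : ∇ f (normalMap f t y) = 0)
    (hrank : Module.finrank ℝ (normalSpace (criticalSet f) (normalMap f t y)) = 1) :
    v ∈ (normalSpace (criticalSet f) (normalMap f t y))ᗮ := by
  intro m hm
  have hν : unitNormal f y ∈ normalSpace (criticalSet f) (normalMap f t y) :=
    (hf.isNormal_add_smul (norm_unitNormal hy) (isNormal_unitNormal hy) t).mem_normalSpace hw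
  have hν0 : unitNormal f y ≠ 0 := norm_ne_zero_iff.1 (by rw [norm_unitNormal hy]; simp)
  obtain ⟨a, ha⟩ := exists_smul_eq_of_finrank_eq_one hrank (x := ⟨_, hν⟩)
    (fun h => hν0 (congrArg Subtype.val h)) ⟨m, hm⟩
  have hma : a • unitNormal f y = m := congrArg Subtype.val ha
  rw [← hma, real_inner_smul_left, hv, mul_zero]

/-- An eigenvalue `μ ≠ 0` would produce a focal direction at distance `-μ⁻¹`. -/
theorem fderiv_unitNormal_eq_zero (hf : IsRegularMetricFunction f)
    (hrank : ∀ w, ∇ f w = 0 → Module.finrank ℝ (normalSpace (criticalSet f) w) = 1)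
    (hy : ∇ f y ≠ 0) : fderiv ℝ (unitNormal f) y = 0 := by
  have hsymm : (fderiv ℝ (unitNormal f) y).toLinearMap.IsSymmetric := fun v w =>
    (hf.isMetricFunction.inner_fderiv_unitNormal_comm hy v w).trans (real_inner_comm _ _)
  refine ContinuousLinearMap.coe_injective
    (eq_zero_of_isSymmetric_of_hasEigenvalue_imp hsymm fun μ hμ => ?_)
  by_contra hμ0
  obtain ⟨v, hv⟩ := hμ.exists_hasEigenvector
  have hTv : fderiv ℝ (unitNormal f) y v = μ • v := hv.apply_eq_smul
  have hperp : ⟪unitNormal f y, v⟫ = 0 := by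
    have := inner_unitNormal_fderiv hf.isMetricFunction.1 hy v
    rw [hTv, inner_smul_right] at this
    exact (mul_eq_zero.1 this).resolve_left hμ0
  refine hv.2 (hf.eq_zero_of_focal hy (t := -μ⁻¹) (fun hw =>
    hf.mem_orthogonal_normalSpace_of_finrank_eq_one hy hperp hw (hrank _ hw)) ?_)
  rw [hTv, smul_smul, neg_mul, inv_mul_cancel₀ hμ0, neg_one_smul, add_neg_cancel]

theorem unitNormal_eq_of_mem_levelSurface (hf : IsRegularMetricFunction f)
    (hflat : ∀ y, ∇ f y ≠ 0 → fderiv ℝ (unitNormal f) y = 0) {x : EuclideanSpace ℝ (Fin n)}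
    (hx : ∇ f x ≠ 0) (hy : y ∈ levelSurface f x) :
    unitNormal f y = unitNormal f x ∧ ⟪unitNormal f x, y⟫ = ⟪unitNormal f x, x⟫ := by
  have hreg (a) (ha : a ∈ levelSurface f x) : ∀ᶠ b in 𝓝 a, ∇ f b ≠ 0 :=
    eventually_gradient_ne_zero hf.contDiff_one
      (hf.isMetricFunction.gradient_ne_zero_of_mem_levelSurface hx ha)
  have hν : unitNormal f y = unitNormal f x :=
    eqOn_levelSurface_of_fderiv_eq_zero_on_ker hf.contDiff_one
      (fun a ha => (hreg a ha).self_of_nhds) (fun a ha => (hreg a ha).mono fun b hb =>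
        ⟨(hasFDerivAt_unitNormal hf.isMetricFunction.1 hb).differentiableAt, fun v _ => by
          rw [hflat b hb]; rfl⟩) hy
  refine ⟨hν, ?_⟩
  have hinner : ⟪unitNormal f y, y⟫ = ⟪unitNormal f x, x⟫ := by
    refine eqOn_levelSurface_of_fderiv_eq_zero_on_ker (k := fun a => ⟪unitNormal f a, a⟫)
      hf.contDiff_one (fun a ha => (hreg a ha).self_of_nhds)
      (fun a ha => (hreg a ha).mono fun b hb => ?_) hy
    have hd : HasFDerivAt (fun a => ⟪unitNormal f a, a⟫) _ b :=
      (hasFDerivAt_unitNormal hf.isMetricFunction.1 hb).inner ℝ (hasFDerivAt_id b)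
    refine ⟨hd.differentiableAt, fun v hv => ?_⟩
    rw [hd.fderiv]
    simp [hflat b hb, (inner_gradient_eq_zero_iff hb).1 hv]
  rwa [hν] at hinner

theorem exists_eq_comp_inner (hf : IsRegularMetricFunction f)
    (hflat : ∀ y, ∇ f y ≠ 0 → fderiv ℝ (unitNormal f) y = 0) :
    ∃ (e : EuclideanSpace ℝ (Fin n)) (h : ℝ → ℝ), e ≠ 0 ∧ ∀ x, f x = h ⟪e, x⟫ := by
  obtain ⟨x₀, hx₀⟩ := (hf.frequently_gradient_ne_zero 0).exists
  have he : ‖unitNormal f x₀‖ = 1 := norm_unitNormal hx₀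
  refine ⟨unitNormal f x₀, fun c => f (normalMap f (c - ⟪unitNormal f x₀, x₀⟫) x₀),
    norm_ne_zero_iff.1 (by rw [he]; simp), fun x => ?_⟩
  obtain ⟨y, hy, hd⟩ := (isClosed_levelSurface hf.contDiff_one.continuous x₀).exists_infDist_eq_dist
    ⟨x₀, mem_levelSurface_self f x₀⟩ x
  obtain ⟨hν, hinner⟩ := hf.unitNormal_eq_of_mem_levelSurface hflat hx₀ hy
  have hsub := hf.isMetricFunction.sub_eq_smul_unitNormal_of_nearest (x := x)
    (hf.isMetricFunction.gradient_ne_zero_of_mem_levelSurface hx₀ hy) fun z hz => by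
      rw [levelSurface_eq_of_mem hy] at hz
      rw [← dist_eq_norm, ← dist_eq_norm, ← hd]
      exact infDist_le_dist_of_mem hz
  have hdist : ⟪unitNormal f x₀, x⟫ - ⟪unitNormal f x₀, x₀⟫ = ⟪unitNormal f y, x - y⟫ := by
    rw [← hinner, hν, inner_sub_right]
  beta_reduce
  rw [← hf.apply_normalMap_eq hx₀ hy, hdist, normalMap, ← hsub, add_sub_cancel]

end IsRegularMetricFunction

end Hyperplanes

section GreatCircles

variable {E : Type*} [NormedAddCommGroup E] [InnerProductSpace ℝ E] {N : Submodule ℝ E}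
  {m b e : E}

theorem exists_unit_orthogonal (hN : 2 ≤ Module.finrank ℝ N) (m : E) :
    ∃ b ∈ N, ‖b‖ = 1 ∧ ⟪m, b⟫ = 0 := by
  have : FiniteDimensional ℝ N := Module.finite_of_finrank_pos (by omega)
  obtain ⟨⟨v, hv⟩, hker, hv0⟩ := Submodule.exists_mem_ne_zero_of_ne_bot
    (LinearMap.ker_ne_bot_of_finrank_lt (f := (innerₛₗ ℝ m).domRestrict N)
      (by rw [Module.finrank_self]; omega))
  refine ⟨NormedSpace.normalize v, N.smul_mem _ hv,
    NormedSpace.norm_normalize fun h => hv0 (Subtype.ext h), ?_⟩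
  rw [NormedSpace.normalize, inner_smul_right, show ⟪m, v⟫ = 0 from hker, mul_zero]

theorem norm_cos_smul_add_sin_smul (hm1 : ‖m‖ = 1) (hb1 : ‖b‖ = 1) (hmb : ⟪m, b⟫ = 0) (θ : ℝ) :
    ‖Real.cos θ • m + Real.sin θ • b‖ = 1 := by
  rw [← sq_eq_sq₀ (norm_nonneg _) zero_le_one, norm_add_sq_real, real_inner_smul_left,
    inner_smul_right, hmb, norm_smul, norm_smul, hm1, hb1, Real.norm_eq_abs, Real.norm_eq_abs]
  simp

theorem exists_eq_cos_smul_add_sin_smul (hN : 2 ≤ Module.finrank ℝ N) (hm : m ∈ N)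
    (hm1 : ‖m‖ = 1) (he : e ∈ N) (he1 : ‖e‖ = 1) :
    ∃ b ∈ N, ‖b‖ = 1 ∧ ⟪m, b⟫ = 0 ∧ ∃ θ : ℝ, e = Real.cos θ • m + Real.sin θ • b := by
  set c : ℝ := ⟪m, e⟫ with hc
  have hcb : |c| ≤ 1 := by simpa [hm1, he1] using abs_real_inner_le_norm m e
  have hmu : ⟪m, e - c • m⟫ = 0 := by
    rw [inner_sub_right, inner_smul_right, real_inner_self_eq_norm_sq, hm1, ← hc]
    ring
  have hnu : ‖e - c • m‖ = √(1 - c ^ 2) := by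
    rw [← Real.sqrt_sq (norm_nonneg _), norm_sub_sq_real, inner_smul_right, norm_smul, hm1, he1,
      real_inner_comm, ← hc, Real.norm_eq_abs, mul_one, sq_abs]
    congr 1
    ring
  obtain ⟨b, hb, hb1, hmb, hub⟩ :
      ∃ b ∈ N, ‖b‖ = 1 ∧ ⟪m, b⟫ = 0 ∧ ‖e - c • m‖ • b = e - c • m := by
    by_cases hu : e - c • m = 0
    · obtain ⟨b, hb, hb1, hmb⟩ := exists_unit_orthogonal hN m
      exact ⟨b, hb, hb1, hmb, by rw [hu, norm_zero, zero_smul]⟩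
    · refine ⟨NormedSpace.normalize (e - c • m), N.smul_mem _ (N.sub_mem he (N.smul_mem _ hm)),
        NormedSpace.norm_normalize hu, ?_, NormedSpace.norm_smul_normalize _⟩
      rw [NormedSpace.normalize, inner_smul_right, hmu, mul_zero]
  refine ⟨b, hb, hb1, hmb, Real.arccos c, ?_⟩
  rw [Real.cos_arccos (abs_le.1 hcb).1 (abs_le.1 hcb).2, Real.sin_arccos, ← hnu, hub,
    add_sub_cancel]

end GreatCircles

section CodimTwo

theorem subsingleton_of_finite_of_reflection_mem {D : Set ℝ} (hD : D.Finite)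
    (hrefl : ∀ a ∈ D, ∀ b ∈ D, 2 * a - b ∈ D) : D.Subsingleton := by
  intro a ha b hb
  obtain ⟨c, hc, hmax⟩ := exists_max_image D id hD ⟨a, ha⟩
  have heq (x) (hx : x ∈ D) : x = c := by
    refine (hmax x hx).antisymm ?_
    have : 2 * c - x ≤ c := hmax _ (hrefl c hc x hx)
    change c ≤ x
    linarith
  rw [heq a ha, heq b hb]

variable {n : ℕ} {f : EuclideanSpace ℝ (Fin n) → ℝ} {p w x y z e m b : EuclideanSpace ℝ (Fin n)}
  {t s τ : ℝ}

theorem criticalComponent_eq_of_mem (hz : z ∈ criticalComponent f w) :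
    criticalComponent f z = criticalComponent f w :=
  (connectedComponentIn_eq hz).symm

theorem isClosed_criticalComponent (hf : ContDiff ℝ 1 f) (hw : ∇ f w = 0) :
    IsClosed (criticalComponent f w) :=
  isClosed_of_closure_subset <|
    isPreconnected_criticalComponent.closure.subset_connectedComponentIn
      (subset_closure (mem_criticalComponent_self hw))
      (closure_minimal (connectedComponentIn_subset _ _) (isClosed_criticalSet hf))

namespace IsRegularMetricFunction

theorem finrank_normalSpace_eq_of_mem_criticalComponent (hf : IsRegularMetricFunction f)
    (hw : ∇ f w = 0) (hz : z ∈ criticalComponent f w) :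
    Module.finrank ℝ (normalSpace (criticalSet f) z) =
      Module.finrank ℝ (normalSpace (criticalSet f) w) := by
  obtain ⟨r, -, hsurf⟩ := hf.exists_isRegularSurface w hw
  have hrank_w := hsurf.finrank_normalSpace (mem_criticalComponent_self hw)
  have hrank_z := hsurf.finrank_normalSpace hz
  rw [← criticalComponent_eq_of_mem hz, hf.normalSpace_criticalComponent
    (gradient_eq_zero_of_mem_criticalComponent hz)] at hrank_z
  rw [hf.normalSpace_criticalComponent hw] at hrank_w
  omega

theorem exists_nearest_mem_criticalComponent (hf : IsRegularMetricFunction f) (hw : ∇ f w = 0)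
    (x : EuclideanSpace ℝ (Fin n)) :
    ∃ q ∈ criticalComponent f w, (∀ a ∈ criticalComponent f w, ‖x - q‖ ≤ ‖x - a‖) ∧
      x - q ∈ normalSpace (criticalSet f) q := by
  obtain ⟨q, hq, hdist⟩ := (isClosed_criticalComponent hf.contDiff_one hw).exists_infDist_eq_dist
    ⟨w, mem_criticalComponent_self hw⟩ x
  have hmin (a) (ha : a ∈ criticalComponent f w) : ‖x - q‖ ≤ ‖x - a‖ := by
    rw [← dist_eq_norm, ← dist_eq_norm, ← hdist]
    exact infDist_le_dist_of_mem ha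
  exact ⟨q, hq, hmin, hf.sub_mem_normalSpace_of_nearest
    (gradient_eq_zero_of_mem_criticalComponent hq) (by rwa [criticalComponent_eq_of_mem hq])⟩

theorem exists_gt_gradient_ne_zero (hf : IsRegularMetricFunction f) (he : ‖e‖ = 1)
    (hx : IsNormal f x e) (t : ℝ) : ∃ s > t, ∇ f (x + s • e) ≠ 0 := by
  obtain ⟨r, hr, hreg⟩ := hf.exists_forall_Ioo_isNormal he (hf.isNormal_add_smul he hx t)
  refine ⟨t + r / 2, by linarith, ?_⟩
  rw [add_smul, ← add_assoc]
  exact (hreg _ ⟨by linarith, by linarith⟩).1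

theorem isNormal_add_smul_of_mem_normalSpace (hf : IsRegularMetricFunction f) (hw : ∇ f w = 0)
    (hm : m ∈ normalSpace (criticalSet f) w) (hm1 : ‖m‖ = 1) (t : ℝ) : IsNormal f (w + t • m) m :=
  hf.isNormal_add_smul hm1 (.of_mem_normalSpace hm hw) t

theorem apply_add_smul_great_circle (hf : IsRegularMetricFunction f) (hw : ∇ f w = 0)
    (hm : m ∈ normalSpace (criticalSet f) w) (hm1 : ‖m‖ = 1)
    (hb : b ∈ normalSpace (criticalSet f) w) (hb1 : ‖b‖ = 1) (hmb : ⟪m, b⟫ = 0) (s θ : ℝ) :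
    f (w + s • (Real.cos θ • m + Real.sin θ • b)) = f (w + s • m) := by
  set u : ℝ → EuclideanSpace ℝ (Fin n) := fun θ => Real.cos θ • m + Real.sin θ • b with hu
  have hderiv (θ : ℝ) : HasDerivAt (fun θ => f (w + s • u θ)) 0 θ := by
    have hcircle : HasDerivAt (fun θ => w + s • u θ)
        (s • (-Real.sin θ • m + Real.cos θ • b)) θ :=
      ((((Real.hasDerivAt_cos θ).smul_const m).add
        ((Real.hasDerivAt_sin θ).smul_const b)).const_smul s).const_add w
    have hal : IsAligned f (w + s • u θ) (u θ) := (hf.isNormal_add_smul_of_mem_normalSpace hw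
      (add_mem (Submodule.smul_mem _ _ hm) (Submodule.smul_mem _ _ hb))
      (norm_cos_smul_add_sin_smul hm1 hb1 hmb θ) s).isAligned
    have htangent : ⟪u θ, s • (-Real.sin θ • m + Real.cos θ • b)⟫ = 0 := by
      simp only [hu, inner_smul_right, inner_add_left, inner_add_right, real_inner_smul_left, hmb,
        real_inner_comm m b, real_inner_self_eq_norm_sq, hm1, hb1]
      ring
    have hcomp := hasDerivAt_comp_of_differentiable hf.differentiable hcircle
    rwa [hal, real_inner_smul_left, htangent, mul_zero] at hcomp
  have := is_const_of_deriv_eq_zero (fun θ => (hderiv θ).differentiableAt)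
    (fun θ => (hderiv θ).deriv) θ 0
  simpa [hu] using this

/-- Rotate the normal line about `w` by the angle `π`: all the while the point at distance `τ`
stays critical. -/
theorem sub_smul_mem_criticalComponent (hf : IsRegularMetricFunction f) (hw : ∇ f w = 0)
    (hrank : 2 ≤ Module.finrank ℝ (normalSpace (criticalSet f) w))
    (hm : m ∈ normalSpace (criticalSet f) w) (hm1 : ‖m‖ = 1) (hτ : ∇ f (w + τ • m) = 0) :
    w - τ • m ∈ criticalComponent f (w + τ • m) := by
  obtain ⟨b, hb, hb1, hmb⟩ := exists_unit_orthogonal hrank m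
  set u : ℝ → EuclideanSpace ℝ (Fin n) := fun θ => Real.cos θ • m + Real.sin θ • b with hu
  have hslope (e : EuclideanSpace ℝ (Fin n)) :
      HasDerivAt (fun s => f (w + s • e)) ⟪∇ f (w + τ • e), e⟫ τ :=
    hasDerivAt_comp_of_differentiable hf.differentiable (hasDerivAt_add_smul w e τ)
  have hcrit (θ : ℝ) : ∇ f (w + τ • u θ) = 0 := by
    have heq : ⟪∇ f (w + τ • u θ), u θ⟫ = ⟪∇ f (w + τ • m), m⟫ :=
      (hslope (u θ)).unique <| (hslope m).congr_of_eventuallyEq <|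
        .of_forall fun s => hf.apply_add_smul_great_circle hw hm hm1 hb hb1 hmb s θ
    rw [(hf.isNormal_add_smul_of_mem_normalSpace hw
      (add_mem (Submodule.smul_mem _ _ hm) (Submodule.smul_mem _ _ hb))
      (norm_cos_smul_add_sin_smul hm1 hb1 hmb θ) τ).isAligned, heq, hτ, inner_zero_left, zero_smul]
  refine (isPreconnected_univ.image (fun θ => w + τ • u θ) ?_).subset_connectedComponentIn
    ⟨0, mem_univ _, ?_⟩ (by rintro _ ⟨θ, -, rfl⟩; exact hcrit θ) ⟨Real.pi, mem_univ _, ?_⟩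
  · fun_prop
  · simp [hu]
  · simp [hu, sub_eq_add_neg]

theorem add_smul_fderiv_unitNormal_eq_zero (hf : IsRegularMetricFunction f) (hy : ∇ f y ≠ 0)
    (hw : ∇ f (normalMap f t y) = 0) (hm : m ∈ normalSpace (criticalSet f) (normalMap f t y))
    (hym : ⟪unitNormal f y, m⟫ = 0) : m + t • fderiv ℝ (unitNormal f) y m = 0 := by
  set A := fderiv ℝ (unitNormal f) y
  have hperp (v) (hv : ⟪unitNormal f y, v⟫ = 0) : ⟪m + t • A m, v⟫ = 0 := by
    obtain ⟨c, rfl, hc, hmem⟩ :=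
      exists_curve_in_levelSurface hf.contDiff_one hy ((inner_gradient_eq_zero_iff hy).2 hv)
    have := inner_eq_zero_of_mem_normalSpace hm
      ((hasFDerivAt_normalMap hf.isMetricFunction.1 hy t).comp_hasDerivAt (0 : ℝ) hc)
      (hmem.mono fun s hs => hf.gradient_normalMap_eq_zero hy hs hw)
    rw [inner_add_left, real_inner_smul_left,
      hf.isMetricFunction.inner_fderiv_unitNormal_comm hy, real_inner_comm]
    simpa [inner_add_right, inner_smul_right, real_inner_comm] using this
  refine ext_inner_right ℝ fun v => ?_
  have hnormal : ⟪m + t • A m, unitNormal f y⟫ = 0 := by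
    rw [real_inner_comm, inner_add_right, hym, inner_smul_right,
      inner_unitNormal_fderiv hf.isMetricFunction.1 hy, mul_zero, add_zero]
  have := hperp (v - ⟪unitNormal f y, v⟫ • unitNormal f y) (by
    rw [inner_sub_right, inner_smul_right, inner_unitNormal_self hy, mul_one, sub_self])
  rwa [inner_sub_right, inner_smul_right, hnormal, mul_zero, sub_zero,
    ← inner_zero_left (𝕜 := ℝ) v] at this

theorem hasEigenvalue_fderiv_unitNormal (hf : IsRegularMetricFunction f) (hy : ∇ f y ≠ 0)
    (hw : ∇ f (normalMap f t y) = 0)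
    (hrank : 2 ≤ Module.finrank ℝ (normalSpace (criticalSet f) (normalMap f t y))) :
    Module.End.HasEigenvalue (fderiv ℝ (unitNormal f) y).toLinearMap (-t⁻¹) := by
  obtain ⟨b, hb, hb1, hyb⟩ := exists_unit_orthogonal hrank (unitNormal f y)
  have ht : t ≠ 0 := by
    rintro rfl
    exact hy (by simpa [normalMap] using hw)
  refine Module.End.hasEigenvalue_of_hasEigenvector (x := b)
    ⟨Module.End.mem_eigenspace_iff.2 ?_, norm_ne_zero_iff.1 (by rw [hb1]; simp)⟩
  have := eq_neg_of_add_eq_zero_right (hf.add_smul_fderiv_unitNormal_eq_zero hy hw hb hyb)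
  rw [neg_smul, ← smul_neg, ← this, inv_smul_smul₀ ht]
  rfl

theorem finite_setOf_codim_two (hf : IsRegularMetricFunction f) (hy : ∇ f y ≠ 0) :
    {t : ℝ | ∇ f (normalMap f t y) = 0 ∧
      2 ≤ Module.finrank ℝ (normalSpace (criticalSet f) (normalMap f t y))}.Finite :=
  .of_injOn (f := fun t : ℝ => -t⁻¹) (fun _ ht => hf.hasEigenvalue_fderiv_unitNormal hy ht.1 ht.2)
    (neg_injective.comp inv_injective).injOn (Module.End.finite_hasEigenvalue _)

/-- Such points of a normal line can be reflected in each other, but are finite in number: seen from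
a regular point of the line, their distances are radii of principal curvature. -/
theorem subsingleton_setOf_codim_two (hf : IsRegularMetricFunction f) (he : ‖e‖ = 1)
    (hx : IsNormal f x e) :
    {t : ℝ | ∇ f (x + t • e) = 0 ∧
      2 ≤ Module.finrank ℝ (normalSpace (criticalSet f) (x + t • e))}.Subsingleton := by
  refine subsingleton_of_finite_of_reflection_mem ?_ fun a ha b hb => ?_
  · obtain ⟨s, -, hs⟩ := hf.exists_gt_gradient_ne_zero he hx 0
    have hfin := hf.finite_setOf_codim_two hs
    rcases (hf.isNormal_add_smul he hx s).isAligned.unitNormal_eq_or he hs with hν | hν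
    · refine (hfin.preimage (sub_left_injective (b := s)).injOn).subset fun t ht => ?_
      have : normalMap f (t - s) (x + s • e) = x + t • e := by rw [normalMap, hν]; module
      rwa [mem_preimage, mem_ofPred_eq, this]
    · refine (hfin.preimage (sub_right_injective (b := s)).injOn).subset fun t ht => ?_
      have : normalMap f (s - t) (x + s • e) = x + t • e := by rw [normalMap, hν]; module
      rwa [mem_preimage, mem_ofPred_eq, this]
  · have hab : x + a • e + (b - a) • e = x + b • e := by module
    have hmem := hf.sub_smul_mem_criticalComponent ha.1 ha.2
      ((hf.isNormal_add_smul he hx a).mem_normalSpace ha.1) he (hab ▸ hb.1)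
    rw [hab, show x + a • e - (b - a) • e = x + (2 * a - b) • e by module] at hmem
    exact ⟨gradient_eq_zero_of_mem_criticalComponent hmem,
      hb.2.trans_eq (hf.finrank_normalSpace_eq_of_mem_criticalComponent hb.1 hmem).symm⟩

theorem exists_sub_eq_smul_of_mem_normalSpace (hf : IsRegularMetricFunction f) (hx : ∇ f x ≠ 0)
    (hm : IsAligned f x m) (hw : ∇ f w = 0) (h : x - w ∈ normalSpace (criticalSet f) w) :
    ∃ c : ℝ, x - w = c • m := by
  have hxw : x - w ≠ 0 := sub_ne_zero.2 fun h => hx (h ▸ hw)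
  set e := NormedSpace.normalize (x - w)
  have he : IsAligned f x e := by
    have := (hf.isNormal_add_smul_of_mem_normalSpace hw (Submodule.smul_mem _ _ h)
      (NormedSpace.norm_normalize hxw) ‖x - w‖).isAligned
    rwa [← NormedSpace.normalize, NormedSpace.norm_smul_normalize, add_sub_cancel] at this
  have hne : ⟪∇ f x, e⟫ ≠ 0 := fun h0 => hx (by rw [he, h0, zero_smul])
  have he_eq : e = (⟪∇ f x, e⟫⁻¹ * ⟪∇ f x, m⟫) • m := by
    rw [mul_smul, ← hm, eq_inv_smul_iff₀ hne, ← he]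
  refine ⟨‖x - w‖ * (⟪∇ f x, e⟫⁻¹ * ⟪∇ f x, m⟫), ?_⟩
  rw [mul_smul, ← he_eq, NormedSpace.norm_smul_normalize]

theorem inner_nonpos_of_mem_criticalComponent (hf : IsRegularMetricFunction f) (hw : ∇ f w = 0)
    (hrank : 2 ≤ Module.finrank ℝ (normalSpace (criticalSet f) w)) (hz : z ∈ criticalComponent f w)
    (hm : m ∈ normalSpace (criticalSet f) w) (hm1 : ‖m‖ = 1) : ⟪m, z - w⟫ ≤ 0 := by
  by_contra! hpos
  have hnormal : IsNormal f w m := .of_mem_normalSpace hm hw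
  obtain ⟨s, hs, hx⟩ :=
    hf.exists_gt_gradient_ne_zero hm1 hnormal (‖z - w‖ ^ 2 / (2 * ⟪m, z - w⟫))
  have hs0 : 0 < s := lt_of_le_of_lt (by positivity) hs
  have hxz : ‖w + s • m - z‖ < s := by
    rw [gt_iff_lt, div_lt_iff₀ (by positivity)] at hs
    refine lt_of_pow_lt_pow_left₀ 2 hs0.le ?_
    rw [show w + s • m - z = s • m - (z - w) by module, norm_sub_sq_real, norm_smul, hm1,
      real_inner_smul_left, Real.norm_of_nonneg hs0.le]
    linarith
  obtain ⟨q, hq, hmin, hqN⟩ := hf.exists_nearest_mem_criticalComponent hw (w + s • m)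
  have hq0 := gradient_eq_zero_of_mem_criticalComponent hq
  obtain ⟨c, hc⟩ := hf.exists_sub_eq_smul_of_mem_normalSpace hx
    (hf.isNormal_add_smul hm1 hnormal s).isAligned hq0 hqN
  have hcs : c < s := by
    have := (hmin z hz).trans_lt hxz
    rw [hc, norm_smul, hm1, mul_one] at this
    exact (le_abs_self c).trans_lt this
  have hq_eq : w + (s - c) • m = q := by rw [sub_smul, ← hc]; module
  have hrank_q := hrank.trans_eq (hf.finrank_normalSpace_eq_of_mem_criticalComponent hw hq).symm
  have : (0 : ℝ) = s - c := hf.subsingleton_setOf_codim_two hm1 hnormal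
    ⟨by rwa [zero_smul, add_zero], by rwa [zero_smul, add_zero]⟩
    ⟨by rwa [hq_eq], by rwa [hq_eq]⟩
  linarith

theorem inner_eq_zero_of_mem_criticalComponent (hf : IsRegularMetricFunction f) (hw : ∇ f w = 0)
    (hrank : 2 ≤ Module.finrank ℝ (normalSpace (criticalSet f) w)) (hz : z ∈ criticalComponent f w)
    (hm : m ∈ normalSpace (criticalSet f) w) : ⟪m, z - w⟫ = 0 := by
  by_cases hm0 : m = 0
  · rw [hm0, inner_zero_left]
  have hu : NormedSpace.normalize m ∈ normalSpace (criticalSet f) w := Submodule.smul_mem _ _ hm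
  have hu1 := NormedSpace.norm_normalize hm0
  have hle := hf.inner_nonpos_of_mem_criticalComponent hw hrank hz hu hu1
  have hge := hf.inner_nonpos_of_mem_criticalComponent hw hrank hz (neg_mem hu) (by rwa [norm_neg])
  rw [inner_neg_left, neg_nonpos] at hge
  rw [← NormedSpace.norm_smul_normalize m, real_inner_smul_left, hle.antisymm hge, mul_zero]

theorem normalSpace_eq_of_mem_criticalComponent (hf : IsRegularMetricFunction f) (hp : ∇ f p = 0)
    (hrank : 2 ≤ Module.finrank ℝ (normalSpace (criticalSet f) p))
    (hw : w ∈ criticalComponent f p) :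
    normalSpace (criticalSet f) w = normalSpace (criticalSet f) p := by
  refine (Submodule.eq_of_le_of_finrank_eq (fun m hm => ?_)
    (hf.finrank_normalSpace_eq_of_mem_criticalComponent hp hw).symm).symm
  rw [← hf.normalSpace_criticalComponent (gradient_eq_zero_of_mem_criticalComponent hw),
    criticalComponent_eq_of_mem hw, mem_normalSpace_iff]
  refine (isLittleO_zero _ _).congr' ?_ EventuallyEq.rfl
  filter_upwards [self_mem_nhdsWithin] with z hz
  rw [← sub_sub_sub_cancel_right z w p, inner_sub_right,
    hf.inner_eq_zero_of_mem_criticalComponent hp hrank hz hm,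
    hf.inner_eq_zero_of_mem_criticalComponent hp hrank hw hm, sub_zero]

theorem criticalComponent_eq_planeThrough (hf : IsRegularMetricFunction f) (hp : ∇ f p = 0)
    (hrank : 2 ≤ Module.finrank ℝ (normalSpace (criticalSet f) p)) :
    criticalComponent f p = planeThrough p (normalSpace (criticalSet f) p)ᗮ := by
  have hsub (z) (hz : z ∈ criticalComponent f p) : z - p ∈ (normalSpace (criticalSet f) p)ᗮ :=
    (Submodule.mem_orthogonal _ _).2 fun m hm =>
      hf.inner_eq_zero_of_mem_criticalComponent hp hrank hz hm
  ext x
  rw [mem_planeThrough]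
  refine ⟨hsub x, fun hx => ?_⟩
  obtain ⟨q, hq, -, hxq⟩ := hf.exists_nearest_mem_criticalComponent hp x
  rw [hf.normalSpace_eq_of_mem_criticalComponent hp hrank hq] at hxq
  have horth := sub_mem hx (hsub q hq)
  rw [sub_sub_sub_cancel_right] at horth
  have hzero := (Submodule.mem_orthogonal _ _).1 horth _ hxq
  rwa [sub_eq_zero.1 (inner_self_eq_zero.1 hzero)]

/-- Rotating about the critical plane and translating along it both preserve `f`. -/
theorem exists_eq_comp_norm (hf : IsRegularMetricFunction f) (hp : ∇ f p = 0)
    (hrank : 2 ≤ Module.finrank ℝ (normalSpace (criticalSet f) p)) :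
    ∃ h : ℝ → ℝ, ∀ v ∈ normalSpace (criticalSet f) p, ∀ w ∈ (normalSpace (criticalSet f) p)ᗮ,
      f (p + v + w) = h ‖v‖ := by
  set N := normalSpace (criticalSet f) p
  obtain ⟨b, hb, hb1, -⟩ := exists_unit_orthogonal hrank 0
  have hmem (w) (hw : w ∈ Nᗮ) : p + w ∈ criticalComponent f p := by
    rw [hf.criticalComponent_eq_planeThrough hp hrank]
    exact ⟨w, hw, rfl⟩
  have hcrit (w) (hw : w ∈ Nᗮ) : ∇ f (p + w) = 0 :=
    gradient_eq_zero_of_mem_criticalComponent (hmem w hw)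
  have hN (w) (hw : w ∈ Nᗮ) : normalSpace (criticalSet f) (p + w) = N :=
    hf.normalSpace_eq_of_mem_criticalComponent hp hrank (hmem w hw)
  have hrot (v) (hv : v ∈ N) (w) (hw : w ∈ Nᗮ) : f (p + v + w) = f (p + w + ‖v‖ • b) := by
    by_cases hv0 : v = 0
    · simp [hv0]
    obtain ⟨a, ha, ha1, hba, θ, hθ⟩ := exists_eq_cos_smul_add_sin_smul hrank hb hb1
      (N.smul_mem _ hv) (NormedSpace.norm_normalize hv0)
    rw [← hf.apply_add_smul_great_circle (hcrit w hw) (by rwa [hN w hw]) hb1 (by rwa [hN w hw])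
      ha1 hba ‖v‖ θ, ← hθ, ← NormedSpace.normalize, NormedSpace.norm_smul_normalize, add_right_comm]
  refine ⟨fun r => f (p + r • b), fun v hv w hw => (hrot v hv w hw).trans ?_⟩
  have hderiv (s : ℝ) : HasDerivAt (fun s : ℝ => f (p + ‖v‖ • b + s • w)) 0 s := by
    have hcomp := hasDerivAt_comp_of_differentiable hf.differentiable
      (hasDerivAt_add_smul (p + ‖v‖ • b) w s)
    have hal := (hf.isNormal_add_smul_of_mem_normalSpace (hcrit _ (Nᗮ.smul_mem s hw))
      (by rwa [hN _ (Nᗮ.smul_mem s hw)]) hb1 ‖v‖).isAligned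
    rw [add_right_comm] at hal
    rwa [hal, real_inner_smul_left, (Submodule.mem_orthogonal _ _).1 hw b hb, mul_zero] at hcomp
  have := is_const_of_deriv_eq_zero (fun s => (hderiv s).differentiableAt)
    (fun s => (hderiv s).deriv) 1 0
  simpa [add_right_comm p w] using this

end IsRegularMetricFunction

end CodimTwo

section AdaptedCharts

variable {E F G α : Type*} [NormedAddCommGroup E] [NormedSpace ℝ E] [NormedAddCommGroup F]
  [NormedSpace ℝ F] [NormedAddCommGroup G] [NormedSpace ℝ G] {m : WithTop ℕ∞} {q : E → α} {x : E}

/-- A `C^m` chart centred at `x` in which `q` is constant along the translates of `K`. When the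
fibres of `q` are the leaves of a foliation, `K` is the direction of the leaves in the chart. -/
structure IsAdaptedChart (m : WithTop ℕ∞) (q : E → α) (K : Submodule ℝ F)
    (T : OpenPartialHomeomorph E F) (x : E) : Prop extends IsCenteredChart m T x where
  eq_of_sub_mem : ∀ y ∈ T.source, ∀ z ∈ T.source, T y - T z ∈ K → q y = q z

theorem exists_continuousLinearEquiv_prod [FiniteDimensional ℝ E] [FiniteDimensional ℝ F]
    [FiniteDimensional ℝ G] (K : Submodule ℝ E) (hF : Module.finrank ℝ F = Module.finrank ℝ K)
    (hG : Module.finrank ℝ F + Module.finrank ℝ G = Module.finrank ℝ E) :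
    ∃ A : E ≃L[ℝ] F × G, ∀ u, A.symm (u, 0) ∈ K := by
  obtain ⟨K', hK⟩ := K.exists_isCompl
  have hK' := Submodule.finrank_add_eq_of_isCompl hK
  let B : (F × G) ≃ₗ[ℝ] E := ((LinearEquiv.ofFinrankEq F K hF).prodCongr
    (LinearEquiv.ofFinrankEq G K' (by omega))).trans (Submodule.prodEquivOfIsCompl K K' hK)
  refine ⟨B.symm.toContinuousLinearEquiv, fun u => ?_⟩
  change B (u, 0) ∈ K
  simp [B]

theorem IsCenteredChart.exists_target_eq_prod {T : OpenPartialHomeomorph E (F × G)}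
    (hT : IsCenteredChart m T x) :
    ∃ (S : OpenPartialHomeomorph E (F × G)) (V₁ : Set F) (V₂ : Set G), IsCenteredChart m S x ∧
      S.target = V₁ ×ˢ V₂ ∧ S.source ⊆ T.source ∧ ⇑S = T := by
  obtain ⟨ε, hε, hball⟩ := Metric.isOpen_iff.1 T.open_target _ hT.zero_mem_target
  have htarget : ball (0 : F) ε ×ˢ ball (0 : G) ε ⊆ T.target := by
    rwa [ball_prod_same]
  let S := (T.symm.restrOpen _ (isOpen_ball.prod isOpen_ball :
    IsOpen (ball (0 : F) ε ×ˢ ball (0 : G) ε))).symm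
  have hsource : S.source ⊆ T.source := inter_subset_left
  refine ⟨S, _, _, ⟨⟨hT.mem_source, ?_⟩, hT.contDiffOn.mono hsource,
    hT.contDiffOn_symm.mono inter_subset_left, hT.apply_self⟩, inter_eq_right.2 htarget,
    hsource, rfl⟩
  change T x ∈ ball (0 : F) ε ×ˢ ball (0 : G) ε
  rw [hT.apply_self]
  exact ⟨mem_ball_self hε, mem_ball_self hε⟩

namespace IsAdaptedChart

theorem trans_continuousLinearEquiv {K : Submodule ℝ F} {T : OpenPartialHomeomorph E F}
    (hT : IsAdaptedChart m q K T x) (A : F ≃L[ℝ] G) :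
    IsAdaptedChart m q (K.comap A.symm.toLinearMap)
      (T.trans A.toHomeomorph.toOpenPartialHomeomorph) x where
  mem_source := by simpa using hT.mem_source
  contDiffOn := A.contDiff.comp_contDiffOn (hT.contDiffOn.mono (by simp))
  contDiffOn_symm := hT.contDiffOn_symm.comp A.symm.contDiff.contDiffOn (by
    intro b hb
    simpa using hb)
  apply_self := (congrArg A hT.apply_self).trans (map_zero A)
  eq_of_sub_mem y hy z hz h := by
    refine hT.eq_of_sub_mem y (by simpa using hy) z (by simpa using hz) ?_
    have : A.symm (A (T y) - A (T z)) ∈ K := h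
    rwa [map_sub, A.symm_apply_apply, A.symm_apply_apply] at this

theorem fiber_inter_source {ψ : OpenPartialHomeomorph E (F × G)} {K : Submodule ℝ (F × G)}
    (hψ : IsAdaptedChart m q K ψ x) (hK : ∀ u, (u, 0) ∈ K) {V₁ : Set F} {V₂ : Set G}
    (htarget : ψ.target = V₁ ×ˢ V₂) (c : α) :
    q ⁻¹' {c} ∩ ψ.source = ψ.symm '' (V₁ ×ˢ {v | v ∈ V₂ ∧ ψ.symm (0, v) ∈ q ⁻¹' {c}}) := by
  have hconst {b : F × G} (hb : b ∈ ψ.target) :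
      (0, b.2) ∈ ψ.target ∧ q (ψ.symm b) = q (ψ.symm (0, b.2)) := by
    have h0 : (0, b.2) ∈ ψ.target := by
      rw [htarget] at hb ⊢
      exact ⟨(htarget ▸ hψ.zero_mem_target : (0 : F × G) ∈ V₁ ×ˢ V₂).1, hb.2⟩
    refine ⟨h0, hψ.eq_of_sub_mem _ (ψ.map_target hb) _ (ψ.map_target h0) ?_⟩
    rw [ψ.right_inv hb, ψ.right_inv h0]
    simpa [Prod.sub_def] using hK b.1
  ext y
  constructor
  · rintro ⟨rfl, hy⟩
    have hb := ψ.map_source hy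
    refine ⟨ψ y, ⟨(htarget ▸ hb).1, (htarget ▸ hb).2, ?_⟩, ψ.left_inv hy⟩
    change q (ψ.symm (0, (ψ y).2)) = q y
    rw [← (hconst hb).2, ψ.left_inv hy]
  · rintro ⟨⟨u, v⟩, ⟨hu, hv, hc⟩, rfl⟩
    have hb : (u, v) ∈ ψ.target := htarget ▸ ⟨hu, hv⟩
    exact ⟨(hconst hb).2.trans hc, ψ.map_target hb⟩

theorem exists_product_chart [FiniteDimensional ℝ E] [FiniteDimensional ℝ F]
    [FiniteDimensional ℝ G] {K : Submodule ℝ E} {T : OpenPartialHomeomorph E E}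
    (hT : IsAdaptedChart m q K T x) (hF : Module.finrank ℝ F = Module.finrank ℝ K)
    (hG : Module.finrank ℝ F + Module.finrank ℝ G = Module.finrank ℝ E) :
    ∃ (ψ : OpenPartialHomeomorph E (F × G)) (V₁ : Set F) (V₂ : Set G), IsCenteredChart m ψ x ∧
      ψ.target = V₁ ×ˢ V₂ ∧ ∀ c, q ⁻¹' {c} ∩ ψ.source =
        ψ.symm '' (V₁ ×ˢ {v | v ∈ V₂ ∧ ψ.symm (0, v) ∈ q ⁻¹' {c}}) := by
  obtain ⟨A, hA⟩ := exists_continuousLinearEquiv_prod K hF hG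
  have hTA := hT.trans_continuousLinearEquiv A
  obtain ⟨ψ, V₁, V₂, hψ, htarget, hsource, hcoe⟩ := hTA.exists_target_eq_prod
  have hψq : IsAdaptedChart m q (K.comap A.symm.toLinearMap) ψ x :=
    ⟨hψ, fun y hy z hz => hcoe ▸ hTA.eq_of_sub_mem y (hsource hy) z (hsource hz)⟩
  exact ⟨ψ, V₁, V₂, hψ, htarget, hψq.fiber_inter_source hA htarget⟩

end IsAdaptedChart

theorem exists_isAdaptedChart_of_eq_of_sub_mem {K : Submodule ℝ E}
    (hq : ∀ y z, y - z ∈ K → q y = q z) (m : WithTop ℕ∞) (x : E) :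
    ∃ T : OpenPartialHomeomorph E E, IsAdaptedChart m q K T x :=
  ⟨(Homeomorph.addRight (-x)).toOpenPartialHomeomorph, ⟨⟨mem_univ _,
    (contDiff_id.add contDiff_const).contDiffOn, (contDiff_id.add contDiff_const).contDiffOn,
    add_neg_cancel x⟩, fun y _ z _ h => hq y z (by simpa using h)⟩⟩

end AdaptedCharts

section Fibers

variable {n : ℕ} {m : WithTop ℕ∞} {α : Type*}

theorem isSingularFoliation_range_fiber {q : EuclideanSpace ℝ (Fin n) → α}
    (hconn : ∀ x, IsPreconnected (q ⁻¹' {q x}))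
    (hchart : ∀ x₀, ∃ k, IsRegularSurface m k (q ⁻¹' {q x₀}) ∧ ∀ x ∈ q ⁻¹' {q x₀},
      ∃ (K : Submodule ℝ (EuclideanSpace ℝ (Fin n))) (T : OpenPartialHomeomorph _ _),
        Module.finrank ℝ K = k ∧ IsAdaptedChart m q K T x) :
    IsSingularFoliation m (range fun x => q ⁻¹' {q x}) where
  isPartition := by
    refine ⟨?_, fun x => ⟨q ⁻¹' {q x}, ⟨⟨x, rfl⟩, rfl⟩, ?_⟩⟩
    · rintro ⟨x, hx⟩
      exact (hx ▸ (rfl : q x = q x) : x ∈ (∅ : Set _))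
    · rintro _ ⟨⟨y, rfl⟩, hy⟩
      simp only [show q x = q y from hy]
  isConnected := by
    rintro _ ⟨x, rfl⟩
    exact ⟨⟨x, rfl⟩, hconn x⟩
  exists_chart := by
    rintro _ ⟨x₀, rfl⟩
    obtain ⟨k, hreg, hT⟩ := hchart x₀
    have hkn : k ≤ n := by
      obtain ⟨K, -, rfl, -⟩ := hT x₀ rfl
      exact K.finrank_le.trans_eq finrank_euclideanSpace_fin
    refine ⟨k, hkn, hreg, fun x hx => ?_⟩
    obtain ⟨K, T, hK, hTx⟩ := hT x hx
    obtain ⟨ψ, V₁, V₂, hψ, htarget, hfiber⟩ := hTx.exists_product_chart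
      (F := EuclideanSpace ℝ (Fin k)) (G := EuclideanSpace ℝ (Fin (n - k)))
      (finrank_euclideanSpace_fin.trans hK.symm)
      (by simp only [finrank_euclideanSpace_fin]; omega)
    refine ⟨ψ, V₁, V₂, hψ.mem_source, hψ.contDiffOn, hψ.contDiffOn_symm, htarget,
      hψ.apply_self, ?_⟩
    rintro _ ⟨y, rfl⟩ -
    exact hfiber (q y)

variable {q : EuclideanSpace ℝ (Fin n) → ℝ}

theorem finrank_orthogonal_singleton_eq_sub_one {a : EuclideanSpace ℝ (Fin n)} (ha : a ≠ 0) :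
    Module.finrank ℝ (ℝ ∙ a)ᗮ = n - 1 := by
  have := (ℝ ∙ a).finrank_add_finrank_orthogonal
  rw [finrank_euclideanSpace_fin, finrank_span_singleton ha] at this
  omega

theorem isRegularSurface_fiber (hq : ContDiff ℝ m q) (hm : m ≠ 0) {c : ℝ}
    (hreg : ∀ x ∈ q ⁻¹' {c}, ∇ q x ≠ 0) : IsRegularSurface m (n - 1) (q ⁻¹' {c}) := by
  rintro x rfl
  have hx := hreg x rfl
  obtain ⟨T, hT, -, hTq⟩ :=
    exists_straightening hq hm hx (hq.differentiable hm x).hasGradientAt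
  refine ⟨T, (ℝ ∙ ∇ q x)ᗮ, hT.mem_source, hT.contDiffOn, hT.contDiffOn_symm,
    finrank_orthogonal_singleton_eq_sub_one hx, fun y _ => ?_⟩
  rw [Submodule.mem_orthogonal_singleton_iff_inner_right, hTq, sub_eq_zero]
  rfl

theorem exists_isAdaptedChart_of_gradient_ne_zero (hq : ContDiff ℝ m q) (hm : m ≠ 0)
    {x : EuclideanSpace ℝ (Fin n)} (hx : ∇ q x ≠ 0) :
    ∃ T : OpenPartialHomeomorph (EuclideanSpace ℝ (Fin n)) (EuclideanSpace ℝ (Fin n)),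
      IsAdaptedChart m q (ℝ ∙ ∇ q x)ᗮ T x := by
  obtain ⟨T, hT, -, hTq⟩ :=
    exists_straightening hq hm hx (hq.differentiable hm x).hasGradientAt
  refine ⟨T, hT, fun y _ z _ h => ?_⟩
  rw [Submodule.mem_orthogonal_singleton_iff_inner_right, inner_sub_right, hTq, hTq] at h
  linarith

end Fibers

section FiberLevelSurfaces

variable {n : ℕ} {f q : EuclideanSpace ℝ (Fin n) → ℝ}

/-- If `q` took two values on a level surface of `f`, it would take all values in between there,
and `f = h ∘ q` would be constant on an open set. -/
theorem levelSurfaces_eq_range_fiber (hf : ∀ x, ∃ᶠ y in 𝓝 x, f y ≠ f x) (hq : Continuous q)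
    {h : ℝ → ℝ} (hfq : ∀ x, f x = h (q x)) (hconn : ∀ x, IsPreconnected (q ⁻¹' {q x})) :
    levelSurfaces f = range fun x => q ⁻¹' {q x} := by
  refine congrArg range (funext fun x => Subset.antisymm (fun y hy => ?_)
    (subset_levelSurface (hconn x) rfl fun y hy => by rw [hfq, hfq, show q y = q x from hy]))
  by_contra hne
  have hvalues : uIcc (q x) (q y) ⊆ q '' levelSurface f x :=
    ((isPreconnected_levelSurface f x).image q hq.continuousOn).ordConnected.uIcc_subset
      ⟨x, mem_levelSurface_self f x, rfl⟩ ⟨y, hy, rfl⟩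
  obtain ⟨c, hc⟩ : (uIoo (q x) (q y)).Nonempty := nonempty_uIoo.2 fun h => hne h.symm
  have hconst {z : EuclideanSpace ℝ (Fin n)} (hz : q z ∈ uIoo (q x) (q y)) : f z = f x := by
    obtain ⟨z', hz', hqz⟩ := hvalues (uIoo_subset_uIcc_self hz)
    rw [hfq, ← hqz, ← hfq, eq_of_mem_levelSurface hz']
  obtain ⟨z, -, rfl⟩ := hvalues (uIoo_subset_uIcc_self hc)
  refine hf z ?_
  filter_upwards [(isOpen_Ioo.preimage hq).mem_nhds hc] with w hw
  rw [not_not, hconst hw, hconst hc]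

theorem IsRegularMetricFunction.frequently_ne (hf : IsRegularMetricFunction f)
    (x : EuclideanSpace ℝ (Fin n)) : ∃ᶠ y in 𝓝 x, f y ≠ f x := by
  intro h
  refine hf.frequently_gradient_ne_zero x ?_
  filter_upwards [eventually_eventually_nhds.2 h] with y hy
  have hconst : f =ᶠ[𝓝 y] fun _ => f x := hy.mono fun z => not_not.1
  rw [not_not, hconst.gradient_eq, gradient_fun_const]

end FiberLevelSurfaces

section HyperplaneFoliation

variable {n : ℕ} {m : WithTop ℕ∞} {f : EuclideanSpace ℝ (Fin n) → ℝ}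
  {e : EuclideanSpace ℝ (Fin n)}

theorem isPreconnected_fiber_inner (c : ℝ) : IsPreconnected ((fun y => ⟪e, y⟫) ⁻¹' {c}) :=
  ((convex_singleton c).linear_preimage (innerSL ℝ e).toLinearMap).isPreconnected

theorem range_fiber_inner (he : e ≠ 0) :
    (range fun x => (fun y => ⟪e, y⟫) ⁻¹' {⟪e, x⟫}) = {L | ∃ c : ℝ, L = {x | ⟪e, x⟫ = c}} := by
  ext L
  refine ⟨fun ⟨x, hx⟩ => ⟨_, hx.symm⟩, ?_⟩
  rintro ⟨c, rfl⟩
  obtain ⟨x, hx⟩ : ∃ x, ⟪e, x⟫ = c := ⟨(c / ‖e‖ ^ 2) • e, by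
    rw [inner_smul_right, real_inner_self_eq_norm_sq,
      div_mul_cancel₀ _ (pow_ne_zero 2 (norm_ne_zero_iff.2 he))]⟩
  exact ⟨x, by simp only [hx]; rfl⟩

theorem isSingularFoliation_hyperplanes (he : e ≠ 0) (hm : m ≠ 0) :
    IsSingularFoliation m {L | ∃ c : ℝ, L = {x | ⟪e, x⟫ = c}} := by
  have hgrad (x : EuclideanSpace ℝ (Fin n)) : ∇ (fun y => ⟪e, y⟫) x ≠ 0 := by
    have : HasGradientAt (fun y => ⟪e, y⟫) e x :=
      hasGradientAt_iff_hasFDerivAt.2 (innerSL ℝ e).hasFDerivAt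
    rwa [this.gradient]
  have hinner : ContDiff ℝ m fun y : EuclideanSpace ℝ (Fin n) => ⟪e, y⟫ :=
    contDiff_const.inner ℝ contDiff_id
  rw [← range_fiber_inner he]
  refine isSingularFoliation_range_fiber (fun _ => isPreconnected_fiber_inner _) fun x₀ =>
    ⟨n - 1, isRegularSurface_fiber hinner hm fun x _ => hgrad x, fun x _ => ?_⟩
  obtain ⟨T, hT⟩ := exists_isAdaptedChart_of_gradient_ne_zero hinner hm (hgrad x)
  exact ⟨_, T, finrank_orthogonal_singleton_eq_sub_one (hgrad x), hT⟩

theorem IsRegularMetricFunction.exists_levelSurfaces_eq_hyperplanes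
    (hf : IsRegularMetricFunction f)
    (hrank : ∀ w, ∇ f w = 0 → Module.finrank ℝ (normalSpace (criticalSet f) w) = 1) :
    ∃ e : EuclideanSpace ℝ (Fin n), e ≠ 0 ∧
      levelSurfaces f = {L | ∃ c : ℝ, L = {x | ⟪e, x⟫ = c}} := by
  obtain ⟨e, h, he, hfe⟩ :=
    hf.exists_eq_comp_inner fun y hy => hf.fderiv_unitNormal_eq_zero hrank hy
  refine ⟨e, he, ?_⟩
  rw [← range_fiber_inner he]
  exact levelSurfaces_eq_range_fiber hf.frequently_ne (continuous_const.inner continuous_id) hfe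
    fun _ => isPreconnected_fiber_inner _

end HyperplaneFoliation

section CylinderFoliation

variable {n : ℕ} {m : WithTop ℕ∞} {p x v w : EuclideanSpace ℝ (Fin n)}
  {W : Submodule ℝ (EuclideanSpace ℝ (Fin n))} {r : ℝ}

/-- The squared distance to the affine plane `p + W`. Unlike the distance, it is smooth. -/
noncomputable def planeDistSq (p : EuclideanSpace ℝ (Fin n))
    (W : Submodule ℝ (EuclideanSpace ℝ (Fin n))) (x : EuclideanSpace ℝ (Fin n)) : ℝ :=
  ‖Wᗮ.starProjection (x - p)‖ ^ 2

theorem contDiff_planeDistSq : ContDiff ℝ m (planeDistSq p W) :=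
  ContDiff.norm_sq ℝ (by fun_prop)

theorem eq_add_starProjection_add_starProjection (p : EuclideanSpace ℝ (Fin n))
    (W : Submodule ℝ (EuclideanSpace ℝ (Fin n))) (x : EuclideanSpace ℝ (Fin n)) :
    x = p + Wᗮ.starProjection (x - p) + W.starProjection (x - p) := by
  rw [add_assoc, add_comm (Wᗮ.starProjection _), W.starProjection_add_starProjection_orthogonal,
    add_sub_cancel]

theorem starProjection_orthogonal_add (hv : v ∈ Wᗮ) (hw : w ∈ W) :
    Wᗮ.starProjection (v + w) = v := by
  rw [map_add, Submodule.starProjection_eq_self_iff.2 hv,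
    (Submodule.starProjection_apply_eq_zero_iff _).2 (W.le_orthogonal_orthogonal hw), add_zero]

theorem planeDistSq_eq_of_sub_mem {y z : EuclideanSpace ℝ (Fin n)} (h : y - z ∈ W) :
    planeDistSq p W y = planeDistSq p W z := by
  have := (Submodule.starProjection_apply_eq_zero_iff Wᗮ).2 (W.le_orthogonal_orthogonal h)
  rw [planeDistSq, ← sub_add_sub_cancel y z p, map_add, this, zero_add, planeDistSq]

theorem mem_roundCylinder : x ∈ roundCylinder p W r ↔ ‖Wᗮ.starProjection (x - p)‖ = r := by
  constructor
  · rintro ⟨v, hv, w, hw, rfl, rfl⟩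
    rw [add_assoc, add_sub_cancel_left, starProjection_orthogonal_add hv hw]
  · rintro rfl
    exact ⟨_, Wᗮ.starProjection_apply_mem _, _, W.starProjection_apply_mem _, rfl,
      eq_add_starProjection_add_starProjection p W x⟩

theorem roundCylinder_bot (p : EuclideanSpace ℝ (Fin n)) (r : ℝ) :
    roundCylinder p ⊥ r = sphere p r := by
  ext x
  rw [mem_roundCylinder, mem_sphere_iff_norm, Submodule.starProjection_eq_self_iff.2 (by simp)]

theorem roundCylinder_zero (p : EuclideanSpace ℝ (Fin n))
    (W : Submodule ℝ (EuclideanSpace ℝ (Fin n))) : roundCylinder p W 0 = planeThrough p W := by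
  ext x
  rw [mem_roundCylinder, norm_eq_zero, Submodule.starProjection_apply_eq_zero_iff,
    Submodule.orthogonal_orthogonal, mem_planeThrough]

theorem planeDistSq_preimage_sq (hr : 0 ≤ r) :
    planeDistSq p W ⁻¹' {r ^ 2} = roundCylinder p W r := by
  ext x
  rw [mem_roundCylinder, ← sq_eq_sq₀ (norm_nonneg _) hr]
  rfl

theorem planeDistSq_preimage_self (p : EuclideanSpace ℝ (Fin n))
    (W : Submodule ℝ (EuclideanSpace ℝ (Fin n))) (x : EuclideanSpace ℝ (Fin n)) :
    planeDistSq p W ⁻¹' {planeDistSq p W x} =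
      roundCylinder p W ‖Wᗮ.starProjection (x - p)‖ :=
  planeDistSq_preimage_sq (norm_nonneg _)

theorem isPreconnected_roundCylinder (hW : 2 ≤ Module.finrank ℝ Wᗮ) (r : ℝ) :
    IsPreconnected (roundCylinder p W r) := by
  have hrank : 1 < Module.rank ℝ Wᗮ := by
    rw [← Module.finrank_eq_rank]
    exact_mod_cast hW
  have himage := ((isPreconnected_sphere hrank (0 : Wᗮ) r).prod
    (isPreconnected_univ (α := W))).image
      (fun z => p + (z.1 : EuclideanSpace ℝ (Fin n)) + z.2) (by fun_prop)
  convert himage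
  ext x
  constructor
  · rintro ⟨v, hv, w, hw, h, rfl⟩
    exact ⟨(⟨v, hv⟩, ⟨w, hw⟩), ⟨by simpa using h, mem_univ _⟩, rfl⟩
  · rintro ⟨⟨v, w⟩, ⟨h, -⟩, rfl⟩
    exact ⟨v, v.2, w, w.2, by simpa using h, rfl⟩

theorem isPreconnected_fiber_planeDistSq (hW : 2 ≤ Module.finrank ℝ Wᗮ)
    (x : EuclideanSpace ℝ (Fin n)) :
    IsPreconnected (planeDistSq p W ⁻¹' {planeDistSq p W x}) := by
  rw [planeDistSq_preimage_self]
  exact isPreconnected_roundCylinder hW _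

theorem range_fiber_planeDistSq (hW : 2 ≤ Module.finrank ℝ Wᗮ) :
    (range fun x => planeDistSq p W ⁻¹' {planeDistSq p W x}) =
      {L | ∃ r : ℝ, 0 < r ∧ L = roundCylinder p W r} ∪ {planeThrough p W} := by
  simp only [planeDistSq_preimage_self]
  ext L
  constructor
  · rintro ⟨x, rfl⟩
    rcases (norm_nonneg (Wᗮ.starProjection (x - p))).eq_or_lt with h | h
    · exact Or.inr (by simp only [← h, roundCylinder_zero, mem_singleton_iff])
    · exact Or.inl ⟨_, h, rfl⟩
  · rintro (⟨r, hr, rfl⟩ | rfl)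
    · have : Nontrivial Wᗮ := Module.nontrivial_of_finrank_pos (R := ℝ) (by omega)
      obtain ⟨v, rfl⟩ := exists_norm_eq Wᗮ hr.le
      refine ⟨p + v, ?_⟩
      simp only [add_sub_cancel_left, Submodule.starProjection_eq_self_iff.2 v.2,
        Submodule.coe_norm]
    · exact ⟨p, by simp only [sub_self, map_zero, norm_zero, roundCylinder_zero]⟩

theorem hasGradientAt_planeDistSq (x : EuclideanSpace ℝ (Fin n)) :
    HasGradientAt (planeDistSq p W) ((2 : ℝ) • Wᗮ.starProjection (x - p)) x := by
  have hproj : HasFDerivAt (fun y => Wᗮ.starProjection (y - p)) Wᗮ.starProjection x :=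
    Wᗮ.starProjection.hasFDerivAt.comp x ((hasFDerivAt_id x).sub_const p)
  refine hasGradientAt_iff_hasFDerivAt.2 (hproj.norm_sq.congr_fderiv ?_)
  ext v
  have := Submodule.inner_starProjection_left_eq_right Wᗮ (Wᗮ.starProjection (x - p)) v
  rw [Submodule.starProjection_eq_self_iff.2 (Wᗮ.starProjection_apply_mem _)] at this
  change 2 • ⟪Wᗮ.starProjection (x - p), Wᗮ.starProjection v⟫ =
    ⟪(2 : ℝ) • Wᗮ.starProjection (x - p), v⟫
  rw [← this, real_inner_smul_left, two_smul, two_mul]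

theorem isSingularFoliation_cylinders (hW : 2 ≤ Module.finrank ℝ Wᗮ) (hm : m ≠ 0) :
    IsSingularFoliation m
      ({L | ∃ r : ℝ, 0 < r ∧ L = roundCylinder p W r} ∪ {planeThrough p W}) := by
  rw [← range_fiber_planeDistSq hW]
  refine isSingularFoliation_range_fiber (isPreconnected_fiber_planeDistSq hW) fun x₀ => ?_
  by_cases hx₀ : planeDistSq p W x₀ = 0
  · refine ⟨Module.finrank ℝ W, ?_, fun x _ => ?_⟩
    · rw [hx₀, ← zero_pow two_ne_zero, planeDistSq_preimage_sq le_rfl, roundCylinder_zero]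
      exact isRegularSurface_planeThrough p W m
    · obtain ⟨T, hT⟩ := exists_isAdaptedChart_of_eq_of_sub_mem
        (fun y z => planeDistSq_eq_of_sub_mem (p := p) (W := W)) m x
      exact ⟨W, T, rfl, hT⟩
  · have hgrad (x) (hx : planeDistSq p W x = planeDistSq p W x₀) :
        ∇ (planeDistSq p W) x ≠ 0 := by
      rw [(hasGradientAt_planeDistSq x).gradient]
      exact smul_ne_zero two_ne_zero (norm_ne_zero_iff.1 (pow_ne_zero_iff two_ne_zero |>.1
        (hx ▸ hx₀ : planeDistSq p W x ≠ 0)))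
    refine ⟨n - 1, isRegularSurface_fiber contDiff_planeDistSq hm hgrad, fun x hx => ?_⟩
    obtain ⟨T, hT⟩ := exists_isAdaptedChart_of_gradient_ne_zero contDiff_planeDistSq hm (hgrad x hx)
    exact ⟨_, T, finrank_orthogonal_singleton_eq_sub_one (hgrad x hx), hT⟩

theorem levelSurfaces_eq_cylinders_of_eq_comp_norm {f : EuclideanSpace ℝ (Fin n) → ℝ}
    {h : ℝ → ℝ} (hW : 2 ≤ Module.finrank ℝ Wᗮ) (hf : ∀ x, ∃ᶠ y in 𝓝 x, f y ≠ f x)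
    (hfh : ∀ v ∈ Wᗮ, ∀ w ∈ W, f (p + v + w) = h ‖v‖) :
    levelSurfaces f =
      {L | ∃ r : ℝ, 0 < r ∧ L = roundCylinder p W r} ∪ {planeThrough p W} := by
  rw [← range_fiber_planeDistSq hW]
  refine levelSurfaces_eq_range_fiber hf (contDiff_planeDistSq (m := 0)).continuous
    (h := fun s => h √s) (fun x => ?_) (isPreconnected_fiber_planeDistSq hW)
  calc f x = f (p + Wᗮ.starProjection (x - p) + W.starProjection (x - p)) :=
        congrArg f (eq_add_starProjection_add_starProjection p W x)
    _ = h ‖Wᗮ.starProjection (x - p)‖ :=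
        hfh _ (Wᗮ.starProjection_apply_mem _) _ (W.starProjection_apply_mem _)
    _ = h √(planeDistSq p W x) := by rw [planeDistSq, Real.sqrt_sq (norm_nonneg _)]

theorem IsRegularSurface.finrank_le_of_add_mem {k : ℕ} {S : Set (EuclideanSpace ℝ (Fin n))}
    (hS : IsRegularSurface 1 k S) (hx : x ∈ S) (hW : ∀ w ∈ W, x + w ∈ S) :
    Module.finrank ℝ W ≤ k := by
  have hnormal : normalSpace S x ≤ Wᗮ := by
    refine fun m hm => (Submodule.mem_orthogonal' _ _).2 fun w hw => ?_
    exact inner_eq_zero_of_mem_normalSpace (c := fun s : ℝ => x + s • w) (by simpa using hm)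
      (hasDerivAt_add_smul x w 0) (.of_forall fun s => hW _ (W.smul_mem s hw))
  have hle := Submodule.finrank_mono hnormal
  have hS' := hS.finrank_normalSpace hx
  have hW' := W.finrank_add_finrank_orthogonal
  rw [finrank_euclideanSpace_fin] at hW'
  omega

namespace IsRegularMetricFunction

variable {f : EuclideanSpace ℝ (Fin n) → ℝ}

theorem levelSurfaces_eq_cylinders (hf : IsRegularMetricFunction f) (hp : ∇ f p = 0)
    (hrank : 2 ≤ Module.finrank ℝ (normalSpace (criticalSet f) p)) :
    levelSurfaces f =
      {L | ∃ r : ℝ, 0 < r ∧ L = roundCylinder p (normalSpace (criticalSet f) p)ᗮ r} ∪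
        {planeThrough p (normalSpace (criticalSet f) p)ᗮ} := by
  obtain ⟨h, hfh⟩ := hf.exists_eq_comp_norm hp hrank
  refine levelSurfaces_eq_cylinders_of_eq_comp_norm (h := h) ?_ hf.frequently_ne ?_
  · rwa [Submodule.orthogonal_orthogonal]
  · intro v hv w hw
    rw [Submodule.orthogonal_orthogonal] at hv
    exact hfh v hv w hw

theorem isLeast_criticalDimensions (hf : IsRegularMetricFunction f) (hp : ∇ f p = 0)
    (hrank : 2 ≤ Module.finrank ℝ (normalSpace (criticalSet f) p)) :
    IsLeast (criticalDimensions f) (Module.finrank ℝ (normalSpace (criticalSet f) p)ᗮ) := by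
  have hF := hf.levelSurfaces_eq_cylinders hp hrank
  have hplane := hf.criticalComponent_eq_planeThrough hp hrank
  set N := normalSpace (criticalSet f) p
  refine ⟨⟨planeThrough p Nᗮ, hF ▸ Or.inr rfl, ?_, isRegularSurface_planeThrough p Nᗮ 1⟩, ?_⟩
  · rw [← hplane]
    exact fun z hz => gradient_eq_zero_of_mem_criticalComponent hz
  · rintro k ⟨L, hL, -, hk⟩
    rw [hF, ← range_fiber_planeDistSq (by rwa [N.orthogonal_orthogonal])] at hL
    obtain ⟨x, rfl⟩ := hL
    refine hk.finrank_le_of_add_mem (x := x) rfl fun w hw => planeDistSq_eq_of_sub_mem ?_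
    rwa [add_sub_cancel_left]

end IsRegularMetricFunction

end CylinderFoliation

theorem mainTheorem1 {n : ℕ} (hn : 1 ≤ n) (f : EuclideanSpace ℝ (Fin n) → ℝ)
    (hf : IsMetricFunction f) (hcrit : HasRegularCriticalSet f) :
    IsSingularFoliation ∞ (levelSurfaces f) ∧
      (IsParallelHyperplanes (levelSurfaces f) ∨
        IsConcentricSpheres (levelSurfaces f) ∨
        ∃ k : ℕ, 1 ≤ k ∧ k + 2 ≤ n ∧ IsLeast (criticalDimensions f) k ∧
          IsConcentricCylinders k (levelSurfaces f)) := by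
  have hreg := hcrit.isRegularMetricFunction hf hn
  by_cases hrank : ∀ w, ∇ f w = 0 → Module.finrank ℝ (normalSpace (criticalSet f) w) = 1
  · obtain ⟨e, he, hF⟩ := hreg.exists_levelSurfaces_eq_hyperplanes hrank
    exact ⟨hF ▸ isSingularFoliation_hyperplanes he (by simp), Or.inl ⟨e, he, hF⟩⟩
  push Not at hrank
  obtain ⟨p, hp, hp1⟩ := hrank
  have hN : 2 ≤ Module.finrank ℝ (normalSpace (criticalSet f) p) := by
    have := hreg.finrank_normalSpace_pos hp
    omega
  have hF := hreg.levelSurfaces_eq_cylinders hp hN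
  have hleast := hreg.isLeast_criticalDimensions hp hN
  have hdim := (normalSpace (criticalSet f) p).finrank_add_finrank_orthogonal
  rw [finrank_euclideanSpace_fin] at hdim
  refine ⟨hF ▸ isSingularFoliation_cylinders (by rwa [Submodule.orthogonal_orthogonal]) (by simp),
    Or.inr ?_⟩
  rcases Nat.eq_zero_or_pos (Module.finrank ℝ (normalSpace (criticalSet f) p)ᗮ) with h0 | h0
  · rw [Submodule.finrank_eq_zero.1 h0] at hF
    simp only [roundCylinder_bot, planeThrough_bot] at hF
    exact Or.inl ⟨p, hF⟩
  · exact Or.inr ⟨_, h0, by omega, hleast, p, _, rfl, hF⟩
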